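/- **Setting.** A fuzzy OSF signature consists of a finite set $S$ of sorts, a set $F$ of features, and a fuzzy subsumption $\preceq\colon S^2\to[0,1]$ that is a fuzzy bounded lattice: $\preceq(s,s)=1$; $\preceq(s,t)\wedge\preceq(t,r)\le\preceq(s,r)$ (with $\wedge=\min$); if $\preceq(s,t)>0$ and $\preceq(t,s)>0$ then $s=t$; $\preceq(\bot,s)=\preceq(s,\top)=1$; and every two sorts have a GLB $s\curlywedge t$. Here and below, a GLB of $T$ is a lower bound $x$ of $T$ (i.e. $\preceq(x,t)>0$ for all $t\in T$) such that $\preceq(y,x)>0$ for every lower bound $y$ of $T$. Let $V$ be a countably infinite set of tags. An OSF term is $t=X:s(f_1\to t_1,\dots,f_n\to t_n)$, $n\ge 0$, with root tag $X\in V$, $s\in S$, $f_i\in F$. It is normal if no sort occurring in it is $\bot$, the features at each occurrence are pairwise distinct, and each tag $Y$ has at most one occurrence as the root of a subterm different from $Y:\top$. For a normal $\psi$ and $X\in\mathrm{Tags}(\psi)$, $\mathrm{Sort}_\psi(X)$ is the most specific $s$ such that $X:s$ appears in $\psi$, and $\phi(\psi)$ is the clause (finite conjunction, up to order) of the constraints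 $X:\mathrm{Sort}_\psi(X)$, one for each tag, and the constraints $X.f\doteq Y$ given by the arguments in $\psi$. An interpretation $I$ has a domain $\Delta$, fuzzy sets $s^I\colon\Delta\to[0,1]$ and functions $f^I\colon\Delta\to\Delta$, with $\top^I=1$, $\bot^I=0$, $s^I(d)\wedge\preceq(s,t)\le t^I(d)$, and $(s\curlywedge t)^I(d)>0$ whenever $s^I(d)\wedge t^I(d)>0$. For an assignment $\alpha\colon V\to\Delta$, $[\![t]\!]_{I,\alpha}(d)=\mathbf 1[d=\alpha(X)]\wedge s^I(d)\wedge\min_i[\![t_i]\!]_{I,\alpha}(f_i^I(d))$ (the empty minimum being $1$), and $[\![t]\!]_I(d)=\sup_\alpha[\![t]\!]_{I,\alpha}(d)$. Subsumption of terms is $\preceq(t_1,t_2)=\sup\{\beta\in[0,1]:[\![t_1]\!]_I(d)\wedge\beta\le[\![t_2]\!]_I(d)\text{ for all }I,d\}$. The unifier $\psi_1\curlywedge\psi_2$ of normal terms is their GLB for this relation among the normal terms and the bottom terms $X:\bot$; it is unique up to equivalence, i.e. any two GLBs have the same denotation in every interpretation. **Procedure** $\mathrm{Unify}(\psi_1,\psi_2)$.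 Start with $\phi=\phi(\psi_1)\ \&\ \phi(\psi_2)\ \&\ X_1\doteq X_2$, where $X_1,X_2$ are the root tags, and apply the following rules in any order until none applies: * $\phi\ \&\ X:s\ \&\ X:s'\ \Rightarrow\ \phi\ \&\ X:s\curlywedge s'$; * $\phi\ \&\ X.f\doteq Y\ \&\ X.f\doteq Y'\ \Rightarrow\ \phi\ \&\ X.f\doteq Y\ \&\ Y\doteq Y'$; * $\phi\ \&\ X:\bot\ \Rightarrow\ X:\bot$ (if $\phi$ is not empty); * $\phi\ \&\ X\doteq Y\ \Rightarrow\ \phi[X/Y]\ \&\ X\doteq Y$ (if $X\ne Y$ and $Y\in\mathrm{Tags}(\phi)$), where $\phi[X/Y]$ replaces every $Y$ with $X$. If the result $\phi$ is an inconsistent clause $X:\bot$, return the term $X:\bot$ and $\beta=1$. Otherwise let $[X]$ be the class of $X\in\mathrm{Tags}(\phi)$ for the equivalence generated by the equalities in $\phi$, choose pairwise distinct new variables $Z_{[X]}\in V\setminus\mathrm{Tags}(\phi)$, rename each $X$ as $Z_{[X]}$ in the part of $\phi$ without equalities, let $\psi$ be a normal term with root tag $Z_{[X_1]}$ whose clause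 $\phi(\psi)$ is the result, and return $\psi$ and $\beta=\min(\beta_1,\beta_2)$, where $$\beta_i=\min\{\preceq(\mathrm{Sort}_\psi(Z_{[X]}),\mathrm{Sort}_{\psi_i}(X)) : X\in\mathrm{Tags}(\psi_i)\}.$$ **Theorem (correctness of Unify).** Let $\psi_1,\psi_2$ be normal OSF terms with no common tags. Then the normalization loop of $\mathrm{Unify}(\psi_1,\psi_2)$ terminates for every choice of the rules applied, and the procedure then returns a pair. For every pair $(\psi,\beta)$ that it may return, $\psi=\psi_1\curlywedge\psi_2$ (up to equivalence), and $\beta=\min(\preceq(\psi,\psi_1),\preceq(\psi,\psi_2))$ is the unification degree of $\psi_1$ and $\psi_2$. -/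

import Mathlib

universe u

namespace OSF

noncomputable section

open Classical

/-- `x` is a fuzzy greatest lower bound of `T` for the fuzzy relation `R` on the carrier `A`:
it is a lower bound (to a positive degree), and every lower bound is below it (to a positive
degree). -/
def IsFuzzyGLB {α : Type*} (R : α → α → unitInterval) (A T : Set α) (x : α) : Prop :=
  x ∈ A ∧ (∀ t ∈ T, 0 < R x t) ∧ ∀ y ∈ A, (∀ t ∈ T, 0 < R y t) → 0 < R y x

/-- A fuzzy bounded lattice of sorts: a fuzzy partial order (for the minimum t-norm) with a least
and a greatest element, in which every pair has a fuzzy greatest lower bound. -/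
structure FuzzyLattice (S : Type u) where
  sub : S → S → unitInterval
  bot : S
  top : S
  sub_refl : ∀ s, sub s s = 1
  sub_trans : ∀ s t r, sub s t ⊓ sub t r ≤ sub s r
  sub_antisymm : ∀ s t, 0 < sub s t → 0 < sub t s → s = t
  bot_sub : ∀ s, sub bot s = 1
  sub_top : ∀ s, sub s top = 1
  exists_glb : ∀ s t, ∃ m, IsFuzzyGLB sub Set.univ {s, t} m

/-- The greatest common subsort of two sorts. -/
def FuzzyLattice.meet {S : Type u} (L : FuzzyLattice S) (s t : S) : S :=
  (L.exists_glb s t).choose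

/-- OSF terms `X : s (f₁ → t₁, …, fₙ → tₙ)`; the case `n = 0` is the sorted variable `X : s`. -/
inductive OSFTerm (S F V : Type u) : Type u where
  | mk (X : V) (s : S) (n : ℕ) (f : Fin n → F) (t : Fin n → OSFTerm S F V) : OSFTerm S F V

namespace OSFTerm

variable {S F V : Type u}

/-- The sorted variable `X : s`. -/
def sortedVar (X : V) (s : S) : OSFTerm S F V :=
  mk X s 0 Fin.elim0 Fin.elim0

/-- The root tag. -/
def root : OSFTerm S F V → V
  | mk X _ _ _ _ => X

/-- The root sort. -/
def rootSort : OSFTerm S F V → S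
  | mk _ s _ _ _ => s

/-- The tags occurring in a term. -/
def tags : OSFTerm S F V → Finset V
  | mk X _ _ _ t => {X} ∪ Finset.univ.biUnion fun i => (t i).tags

/-- All subterms of a term (the term itself included), one for each occurrence. -/
def subterms : OSFTerm S F V → Multiset (OSFTerm S F V)
  | mk X s n f t => mk X s n f t ::ₘ ∑ i, (t i).subterms

/-- Conditions (i), (ii), (iii) of normality: no occurrence carries the bottom sort, and the
features listed at an occurrence are pairwise distinct. -/
def LocallyNormal (L : FuzzyLattice S) : OSFTerm S F V → Prop
  | mk _ s _ f t => s ≠ L.bot ∧ Function.Injective f ∧ ∀ i, (t i).LocallyNormal L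

/-- Normal OSF terms (`ψ`-terms): moreover, each tag `Y` has at most one occurrence as the root of
a subterm different from `Y : ⊤`. -/
def IsNormal (L : FuzzyLattice S) (t : OSFTerm S F V) : Prop :=
  t.LocallyNormal L ∧
    ∀ Y ∈ t.tags,
      (t.subterms.filter fun r => r.root = Y ∧ r ≠ sortedVar Y L.top).card ≤ 1

/-- `X : s` appears in `t`. -/
def Appears (t : OSFTerm S F V) (X : V) (s : S) : Prop :=
  ∃ r ∈ t.subterms, r.root = X ∧ r.rootSort = s

/-- The most specific sort `s` such that `X : s` appears in `t` (it exists when `t` is normal and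
`X` is a tag of `t`; the value is `⊤` when there is none). -/
def sortOf (L : FuzzyLattice S) (t : OSFTerm S F V) (X : V) : S :=
  if h : ∃ s, t.Appears X s ∧ ∀ s', t.Appears X s' → 0 < L.sub s s' then h.choose else L.top

end OSFTerm

/-- OSF constraints `X : s`, `X ≐ Y` and `X.f ≐ Y`. -/
inductive Constraint (S F V : Type u) : Type u where
  | sort (X : V) (s : S) : Constraint S F V
  | eq (X Y : V) : Constraint S F V
  | feat (X : V) (f : F) (Y : V) : Constraint S F V

namespace Constraint

variable {S F V : Type u}

/-- The tags of a constraint. -/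
def tags : Constraint S F V → Finset V
  | sort X _ => {X}
  | eq X Y => {X, Y}
  | feat X _ Y => {X, Y}

/-- Apply a map of variables to a constraint. -/
def rename (z : V → V) : Constraint S F V → Constraint S F V
  | sort X s => sort (z X) s
  | eq X Y => eq (z X) (z Y)
  | feat X f Y => feat (z X) f (z Y)

/-- The constraint is not an equality `X ≐ Y`. -/
def NotEq : Constraint S F V → Prop
  | eq _ _ => False
  | _ => True

end Constraint

/-- An OSF clause: a finite conjunction of constraints, up to order. -/
abbrev Clause (S F V : Type u) : Type u := Multiset (Constraint S F V)

namespace Clause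

variable {S F V : Type u}

/-- `X ∈ Tags(φ)`. -/
def HasTag (φ : Clause S F V) (X : V) : Prop := ∃ c ∈ φ, X ∈ c.tags

/-- `φ[X/Y]`: every occurrence of `Y` is replaced with `X`. -/
def subst (φ : Clause S F V) (X Y : V) : Clause S F V :=
  φ.map (Constraint.rename fun W => if W = Y then X else W)

/-- The subclause without the equality constraints. -/
def solved (φ : Clause S F V) : Clause S F V := φ.filter Constraint.NotEq

/-- The equivalence of tags generated by the equality constraints of `φ`. -/
def TagEquiv (φ : Clause S F V) : V → V → Prop :=
  Relation.ReflTransGen fun X Y => Constraint.eq X Y ∈ φ ∨ Constraint.eq Y X ∈ φ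

end Clause

/-- The constraint normalization rules. -/
inductive Step {S F V : Type u} (L : FuzzyLattice S) : Clause S F V → Clause S F V → Prop where
  /-- Fuzzy Sort Intersection. -/
  | sortIntersection (φ : Clause S F V) (X : V) (s s' : S) :
      Step L (Constraint.sort X s ::ₘ Constraint.sort X s' ::ₘ φ)
        (Constraint.sort X (L.meet s s') ::ₘ φ)
  /-- Feature Functionality. -/
  | featureFunctionality (φ : Clause S F V) (X : V) (f : F) (Y Y' : V) :
      Step L (Constraint.feat X f Y ::ₘ Constraint.feat X f Y' ::ₘ φ)
        (Constraint.feat X f Y ::ₘ Constraint.eq Y Y' ::ₘ φ)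
  /-- Inconsistent Sort (not applied to the inconsistent clause itself). -/
  | inconsistentSort (φ : Clause S F V) (X : V) (hφ : φ ≠ 0) :
      Step L (Constraint.sort X L.bot ::ₘ φ) {Constraint.sort X L.bot}
  /-- Tag Elimination (not applied to a trivial equality). -/
  | tagElimination (φ : Clause S F V) (X Y : V) (hXY : X ≠ Y) (hY : φ.HasTag Y) :
      Step L (Constraint.eq X Y ::ₘ φ) (Constraint.eq X Y ::ₘ φ.subst X Y)

namespace OSFTerm

variable {S F V : Type u}

/-- The feature constraints `X.f ≐ Y` given by the arguments of the subterms of a term. -/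
def featClause : OSFTerm S F V → Clause S F V
  | mk X _ _ f t => ∑ i, (Constraint.feat X (f i) (t i).root ::ₘ (t i).featClause)

/-- The (solved) clause `φ(ψ)` of a normal term `ψ`: one sort constraint `X : Sort_ψ(X)` for each
tag, and the feature constraints of `ψ`. Its root is the root tag of `ψ`. -/
def toClause (L : FuzzyLattice S) (t : OSFTerm S F V) : Clause S F V :=
  (t.tags.val.map fun X => Constraint.sort X (t.sortOf L X)) + t.featClause

end OSFTerm

/-- A fuzzy OSF interpretation over the sorts `L` and the features `F`. -/
structure Interpretation {S : Type u} (L : FuzzyLattice S) (F : Type u) where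
  Dom : Type u
  sort : S → Dom → unitInterval
  feat : F → Dom → Dom
  sort_top : ∀ d, sort L.top d = 1
  sort_bot : ∀ d, sort L.bot d = 0
  sort_sub : ∀ s t d, sort s d ⊓ L.sub s t ≤ sort t d
  sort_meet : ∀ s t d, 0 < sort s d ⊓ sort t d → 0 < sort (L.meet s t) d

namespace OSFTerm

variable {S F V : Type u}

/-- The denotation of a term under an assignment. -/
def denotAt {L : FuzzyLattice S} (I : Interpretation L F) (α : V → I.Dom) :
    OSFTerm S F V → I.Dom → unitInterval
  | mk X s _ f t, d =>
      (if d = α X then 1 else 0) ⊓ I.sort s d ⊓ ⨅ i, (t i).denotAt I α (I.feat (f i) d)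

/-- The denotation of a term in an interpretation. -/
def denot {L : FuzzyLattice S} (I : Interpretation L F) (t : OSFTerm S F V) (d : I.Dom) :
    unitInterval :=
  ⨆ α : V → I.Dom, t.denotAt I α d

/-- The (semantic) fuzzy subsumption degree of two terms. -/
def sub (L : FuzzyLattice S) (t₁ t₂ : OSFTerm S F V) : unitInterval :=
  sSup {β | ∀ (I : Interpretation L F) (d : I.Dom), t₁.denot I d ⊓ β ≤ t₂.denot I d}

/-- Semantic equivalence of terms: the same denotation in every interpretation. -/
def SameDenotation (L : FuzzyLattice S) (t₁ t₂ : OSFTerm S F V) : Prop :=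
  ∀ (I : Interpretation L F) (d : I.Dom), t₁.denot I d = t₂.denot I d

/-- The elements of the term lattice: the normal terms, and the bottom terms `X : ⊥`. -/
def latticeTerms (L : FuzzyLattice S) : Set (OSFTerm S F V) :=
  {t | t.IsNormal L ∨ ∃ X, t = sortedVar X L.bot}

/-- `ψ` is the unifier of `ψ₁` and `ψ₂`: their greatest lower bound for the fuzzy subsumption of
terms, which is unique up to equivalence. -/
def IsUnifier (L : FuzzyLattice S) (ψ₁ ψ₂ ψ : OSFTerm S F V) : Prop :=
  IsFuzzyGLB (sub L) (latticeTerms L) {ψ₁, ψ₂} ψ ∧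
    ∀ ψ', IsFuzzyGLB (sub L) (latticeTerms L) {ψ₁, ψ₂} ψ' → SameDenotation L ψ' ψ

/-- `ψ` is the unifier of `ψ₁` and `ψ₂`, with unification degree `β`. -/
def IsUnifierWithDegree (L : FuzzyLattice S) (ψ₁ ψ₂ ψ : OSFTerm S F V) (β : unitInterval) : Prop :=
  IsUnifier L ψ₁ ψ₂ ψ ∧ β = sub L ψ ψ₁ ⊓ sub L ψ ψ₂

end OSFTerm

section Unify

variable {S F V : Type u}

/-- The clause `φ(ψ₁) & φ(ψ₂) & root(ψ₁) ≐ root(ψ₂)` from which the procedure starts. -/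
def initialClause (L : FuzzyLattice S) (ψ₁ ψ₂ : OSFTerm S F V) : Clause S F V :=
  ψ₁.toClause L + ψ₂.toClause L + {Constraint.eq ψ₁.root ψ₂.root}

/-- `φ` is a possible value of the clause when the normalization loop ends. -/
def IsNormalization (L : FuzzyLattice S) (ψ₁ ψ₂ : OSFTerm S F V) (φ : Clause S F V) : Prop :=
  Relation.ReflTransGen (Step L) (initialClause L ψ₁ ψ₂) φ ∧ ∀ φ', ¬ Step L φ φ'

/-- `z X` is the new variable `Z_[X]` of the class `[X]` of `X`, for every tag `X` of `φ`. -/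
def IsClassNaming (φ : Clause S F V) (z : V → V) : Prop :=
  ∀ X, φ.HasTag X → ¬ φ.HasTag (z X) ∧ ∀ Y, φ.HasTag Y → (z X = z Y ↔ φ.TagEquiv X Y)

/-- The minimum of the degrees `≼(Sort_ψ(Z_[X]), Sort_ψᵢ(X))` over the tags `X` of `ψᵢ`. -/
def tagDegree (L : FuzzyLattice S) (ψ ψᵢ : OSFTerm S F V) (z : V → V) : unitInterval :=
  ψᵢ.tags.inf fun X => L.sub (ψ.sortOf L (z X)) (ψᵢ.sortOf L X)

/-- The procedure, having reached the normalized clause `φ`, returns `(ψ, β)`. If `φ` is the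
inconsistent clause `X : ⊥`, it returns the term `X : ⊥` with degree `1`. Otherwise it renames the
solved part of `φ` along the tag classes, returns a normal term `ψ` that has this clause (rooted at
the class of the root tags), and computes `β` along the two maps `X ↦ Z_[X]`. -/
def Returns (L : FuzzyLattice S) (ψ₁ ψ₂ : OSFTerm S F V) (φ : Clause S F V)
    (ψ : OSFTerm S F V) (β : unitInterval) : Prop :=
  (∃ X, φ = {Constraint.sort X L.bot} ∧ ψ = OSFTerm.sortedVar X L.bot ∧ β = 1) ∨
  ((¬ ∃ X, φ = {Constraint.sort X L.bot}) ∧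
    ∃ z : V → V, IsClassNaming φ z ∧
      ψ.IsNormal L ∧ ψ.root = z ψ₁.root ∧
      ψ.toClause L = φ.solved.map (Constraint.rename z) ∧
      β = tagDegree L ψ ψ₁ z ⊓ tagDegree L ψ ψ₂ z)

/-- `(ψ, β)` is an output of the (nondeterministic) procedure `Unify(ψ₁, ψ₂)`. -/
def UnifyOutput (L : FuzzyLattice S) (ψ₁ ψ₂ ψ : OSFTerm S F V) (β : unitInterval) : Prop :=
  ∃ φ, IsNormalization L ψ₁ ψ₂ φ ∧ Returns L ψ₁ ψ₂ φ ψ β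

end Unify

end

end OSF

namespace OSF

noncomputable section

open Classical

variable {S F V : Type u}

/-! ### Greatest lower bounds of sorts. -/

namespace FuzzyLattice

/-! A normal term holds at a point to the degree to which some assignment with that root value
satisfies its clause. Since features denote total functions, the root value determines such an
assignment on all tags (`eq_on_tags`). Each normal term `t` has a canonical interpretation, made of
tags followed by words of features that extend freely where `t` has no argument. An assignment
satisfying the clause of `t` in `I` to degree `γ > 0` extends to a map into `I` that commutes with
features and loses at most `γ` on sorts. Hence subsumption of `t` by any term is the degree of that
term at the canonical root of `t` (`IsNormal.sub_eq`).

Lower bounds and greatest lower bounds only ask for positive degrees. The rules do not preserve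
degrees, but they do preserve the set of assignments that satisfy a clause positively
(`Step.pos_iff`). So a lower bound of both terms, which gives one common solution of the initial
clause because the tags are disjoint, also solves the final clause, and conversely. This makes the
output a GLB. Its degree is then read off the original terms: the only relevant assignment into the
canonical interpretation of `ψ` is `X ↦ Z_[X]`, and its value is the minimum of the sort degrees
(`IsNormal.sub_eq_tagDegree`). Uniqueness holds because normal terms below each other to positive
degrees are so to degree 1 (`IsNormal.sub_eq_one`).

Termination comes from a natural number that every rule decreases (`Step.weight_lt`). That an output
exists has two ingredients: the rules lose no tag or constraint up to the equalities
(`Step.refines`), so the final clause stays sorted and connected to the root, and such a clause is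
unfolded into a term by growing leaves (`RootedSolved.exists_toClause_eq`). -/

theorem meet_spec (L : FuzzyLattice S) (s t : S) : IsFuzzyGLB L.sub Set.univ {s, t} (L.meet s t) :=
  (L.exists_glb s t).choose_spec

theorem meet_sub_left (L : FuzzyLattice S) (s t : S) : 0 < L.sub (L.meet s t) s :=
  (L.meet_spec s t).2.1 s (by simp)

theorem meet_sub_right (L : FuzzyLattice S) (s t : S) : 0 < L.sub (L.meet s t) t :=
  (L.meet_spec s t).2.1 t (by simp)

theorem sub_meet (L : FuzzyLattice S) {r s t : S} (hs : 0 < L.sub r s) (ht : 0 < L.sub r t) :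
    0 < L.sub r (L.meet s t) :=
  (L.meet_spec s t).2.2 r trivial (by simp [hs, ht])

theorem sub_bot_eq_zero (L : FuzzyLattice S) {s : S} (hs : s ≠ L.bot) : L.sub s L.bot = 0 := by
  by_contra h
  exact hs (L.sub_antisymm _ _ (pos_iff_ne_zero.2 h) (by rw [L.bot_sub]; exact zero_lt_one))

end FuzzyLattice

/-! ### Tags, subterms and sorts of normal terms. -/

namespace OSFTerm

@[simp] theorem root_mk (X : V) (s : S) (n : ℕ) (f : Fin n → F) (t : Fin n → OSFTerm S F V) :
    (mk X s n f t).root = X := rfl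

@[simp] theorem rootSort_mk (X : V) (s : S) (n : ℕ) (f : Fin n → F) (t : Fin n → OSFTerm S F V) :
    (mk X s n f t).rootSort = s := rfl

theorem mem_tags_mk {X Y : V} {s : S} {n : ℕ} {f : Fin n → F} {t : Fin n → OSFTerm S F V} :
    Y ∈ (mk X s n f t).tags ↔ Y = X ∨ ∃ i, Y ∈ (t i).tags := by
  simp [tags]

theorem mem_subterms_mk {r : OSFTerm S F V} {X : V} {s : S} {n : ℕ} {f : Fin n → F}
    {t : Fin n → OSFTerm S F V} :
    r ∈ (mk X s n f t).subterms ↔ r = mk X s n f t ∨ ∃ i, r ∈ (t i).subterms := by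
  simp [subterms, Multiset.mem_sum]

theorem mem_featClause_mk {c : Constraint S F V} {X : V} {s : S} {n : ℕ} {f : Fin n → F}
    {t : Fin n → OSFTerm S F V} :
    c ∈ (mk X s n f t).featClause ↔
      ∃ i, c = Constraint.feat X (f i) (t i).root ∨ c ∈ (t i).featClause := by
  simp [featClause, Multiset.mem_sum]

theorem root_mem_tags (t : OSFTerm S F V) : t.root ∈ t.tags := by
  cases t; simp [tags]

theorem mem_tags_iff {t : OSFTerm S F V} {X : V} : X ∈ t.tags ↔ ∃ r ∈ t.subterms, r.root = X := by
  induction t with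
  | mk Y s n f t ih =>
    simp only [mem_tags_mk, mem_subterms_mk, ih]
    constructor
    · rintro (rfl | ⟨i, r, hr, rfl⟩)
      · exact ⟨_, Or.inl rfl, rfl⟩
      · exact ⟨r, Or.inr ⟨i, hr⟩, rfl⟩
    · rintro ⟨r, rfl | ⟨i, hr⟩, rfl⟩
      · exact Or.inl rfl
      · exact Or.inr ⟨i, r, hr, rfl⟩

theorem mem_featClause_iff {t : OSFTerm S F V} {c : Constraint S F V} :
    c ∈ t.featClause ↔ ∃ X s n f u, mk X s n f u ∈ t.subterms ∧
      ∃ i, c = Constraint.feat X (f i) (u i).root := by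
  induction t with
  | mk Y s n f t ih =>
    simp only [mem_featClause_mk, mem_subterms_mk, ih]
    constructor
    · rintro ⟨i, rfl | ⟨X, s, n, f, u, hr, j, rfl⟩⟩
      · exact ⟨_, _, _, _, _, Or.inl rfl, i, rfl⟩
      · exact ⟨_, _, _, _, _, Or.inr ⟨i, hr⟩, j, rfl⟩
    · rintro ⟨X, s, n, f, u, hr | ⟨i, hr⟩, j, rfl⟩
      · cases hr
        exact ⟨j, Or.inl rfl⟩
      · exact ⟨i, Or.inr ⟨_, _, _, _, _, hr, j, rfl⟩⟩

theorem featClause_tags {t : OSFTerm S F V} {X Y : V} {f : F}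
    (h : Constraint.feat X f Y ∈ t.featClause) : X ∈ t.tags ∧ Y ∈ t.tags := by
  induction t with
  | mk Z s n g t ih =>
    obtain ⟨i, h | h⟩ := mem_featClause_mk.1 h
    · cases h
      exact ⟨mem_tags_mk.2 (Or.inl rfl), mem_tags_mk.2 (Or.inr ⟨i, root_mem_tags _⟩)⟩
    · exact ⟨mem_tags_mk.2 (Or.inr ⟨i, (ih i h).1⟩), mem_tags_mk.2 (Or.inr ⟨i, (ih i h).2⟩)⟩

theorem LocallyNormal.subterm {L : FuzzyLattice S} {t r : OSFTerm S F V} (ht : t.LocallyNormal L)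
    (hr : r ∈ t.subterms) : r.LocallyNormal L := by
  induction t with
  | mk Z s n g t ih =>
    obtain rfl | ⟨i, hr⟩ := mem_subterms_mk.1 hr
    · exact ht
    · exact ih i (ht.2.2 i) hr

theorem LocallyNormal.rootSort_ne_bot {L : FuzzyLattice S} {t : OSFTerm S F V}
    (ht : t.LocallyNormal L) : t.rootSort ≠ L.bot := by
  cases t; exact ht.1

theorem LocallyNormal.top_ne_bot {L : FuzzyLattice S} {t : OSFTerm S F V}
    (ht : t.LocallyNormal L) : L.top ≠ L.bot := by
  intro h
  refine ht.rootSort_ne_bot (L.sub_antisymm _ _ ?_ ?_)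
  · rw [← h, L.sub_top]; exact zero_lt_one
  · rw [L.bot_sub]; exact zero_lt_one

theorem IsNormal.eq_of_root_eq {L : FuzzyLattice S} {t r r' : OSFTerm S F V} (ht : t.IsNormal L)
    (hr : r ∈ t.subterms) (hr' : r' ∈ t.subterms) (h : r.root = r'.root)
    (hn : r ≠ sortedVar r.root L.top) (hn' : r' ≠ sortedVar r'.root L.top) : r = r' := by
  have hmem : r ∈ t.subterms.filter fun q => q.root = r.root ∧ q ≠ sortedVar r.root L.top :=
    Multiset.mem_filter.2 ⟨hr, rfl, hn⟩
  have hmem' : r' ∈ t.subterms.filter fun q => q.root = r.root ∧ q ≠ sortedVar r.root L.top :=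
    Multiset.mem_filter.2 ⟨hr', h.symm, h ▸ hn'⟩
  obtain ⟨q, hq⟩ := Multiset.card_eq_one.1 (le_antisymm (ht.2 r.root (mem_tags_iff.2 ⟨r, hr, rfl⟩))
    (Multiset.card_pos_iff_exists_mem.2 ⟨r, hmem⟩))
  rw [hq, Multiset.mem_singleton] at hmem hmem'
  rw [hmem, hmem']

/-- A subterm with an argument is never a bare `X : ⊤`, so both constraints come from the same
subterm, whose features are pairwise distinct. -/
theorem IsNormal.feat_unique {L : FuzzyLattice S} {t : OSFTerm S F V} (ht : t.IsNormal L)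
    {X Y Y' : V} {f : F} (h : Constraint.feat X f Y ∈ t.featClause)
    (h' : Constraint.feat X f Y' ∈ t.featClause) : Y = Y' := by
  obtain ⟨Z, s, n, g, u, hr, i, hi⟩ := mem_featClause_iff.1 h
  obtain ⟨Z', s', n', g', u', hr', i', hi'⟩ := mem_featClause_iff.1 h'
  cases hi
  obtain ⟨rfl, hg, rfl⟩ := Constraint.feat.inj hi'
  have key := ht.eq_of_root_eq hr hr' rfl
    (by intro h; simp only [sortedVar, mk.injEq] at h; obtain ⟨-, -, rfl, -⟩ := h; exact i.elim0)
    (by intro h; simp only [sortedVar, mk.injEq] at h; obtain ⟨-, -, rfl, -⟩ := h; exact i'.elim0)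
  cases key
  rw [(ht.1.subterm hr).2.1 hg]

theorem Appears.mem_tags {t : OSFTerm S F V} {X : V} {s : S} (h : t.Appears X s) : X ∈ t.tags := by
  obtain ⟨r, hr, rfl, -⟩ := h
  exact mem_tags_iff.2 ⟨r, hr, rfl⟩

theorem Appears.ne_bot {L : FuzzyLattice S} {t : OSFTerm S F V} {X : V} {s : S}
    (ht : t.LocallyNormal L) (h : t.Appears X s) : s ≠ L.bot := by
  obtain ⟨r, hr, -, rfl⟩ := h
  exact (ht.subterm hr).rootSort_ne_bot

/-- A most specific sort that appears with a tag is the sort of that tag. -/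
theorem sortOf_eq {L : FuzzyLattice S} {t : OSFTerm S F V} {X : V} {s : S} (h : t.Appears X s)
    (hs : ∀ s', t.Appears X s' → 0 < L.sub s s') : t.sortOf L X = s := by
  have hex : ∃ s, t.Appears X s ∧ ∀ s', t.Appears X s' → 0 < L.sub s s' := ⟨s, h, hs⟩
  rw [sortOf, dif_pos hex]
  exact L.sub_antisymm _ _ (hex.choose_spec.2 _ h) (hs _ hex.choose_spec.1)

theorem IsNormal.eq_of_appears {L : FuzzyLattice S} {t : OSFTerm S F V} (ht : t.IsNormal L) {X : V}
    {s s' : S} (h : t.Appears X s) (h' : t.Appears X s') (hs : s ≠ L.top) (hs' : s' ≠ L.top) :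
    s = s' := by
  obtain ⟨r, hr, hX, rfl⟩ := h
  obtain ⟨r', hr', hX', rfl⟩ := h'
  rw [ht.eq_of_root_eq hr hr' (hX.trans hX'.symm)]
  · intro h; rw [h] at hs; exact hs rfl
  · intro h; rw [h] at hs'; exact hs' rfl

/-- At most one sort other than `⊤` can appear with a given tag, so the most specific sort is that
one if it exists, and `⊤` otherwise. -/
theorem IsNormal.appears_sortOf {L : FuzzyLattice S} {t : OSFTerm S F V} (ht : t.IsNormal L) {X : V}
    (hX : X ∈ t.tags) : t.Appears X (t.sortOf L X) ∧
      ∀ s, t.Appears X s → s = t.sortOf L X ∨ s = L.top := by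
  by_cases h : ∃ s, t.Appears X s ∧ s ≠ L.top
  · obtain ⟨s, hs, hst⟩ := h
    have key : ∀ s', t.Appears X s' → s' = s ∨ s' = L.top := fun s' hs' => by
      by_cases h : s' = L.top
      · exact Or.inr h
      · exact Or.inl (ht.eq_of_appears hs' hs h hst)
    have : t.sortOf L X = s := sortOf_eq hs fun s' hs' => by
      obtain rfl | rfl := key s' hs'
      · rw [L.sub_refl]; exact zero_lt_one
      · rw [L.sub_top]; exact zero_lt_one
    rw [this]
    exact ⟨hs, key⟩
  · push Not at h
    obtain ⟨r, hr, rfl⟩ := mem_tags_iff.1 hX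
    have hr' : t.Appears r.root r.rootSort := ⟨r, hr, rfl, rfl⟩
    have : t.sortOf L r.root = L.top := sortOf_eq (h _ hr' ▸ hr') fun s' hs' => by
      rw [h _ hs', L.sub_refl]; exact zero_lt_one
    rw [this]
    exact ⟨h _ hr' ▸ hr', fun s hs => Or.inr (h s hs)⟩

theorem IsNormal.sortOf_ne_bot {L : FuzzyLattice S} {t : OSFTerm S F V} (ht : t.IsNormal L)
    (X : V) : t.sortOf L X ≠ L.bot := by
  by_cases hX : X ∈ t.tags
  · exact (ht.appears_sortOf hX).1.ne_bot ht.1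
  · rw [sortOf, dif_neg]
    · exact ht.1.top_ne_bot
    · rintro ⟨s, h, -⟩
      exact hX h.mem_tags

theorem sortOf_of_notMem {L : FuzzyLattice S} {t : OSFTerm S F V} {X : V} (hX : X ∉ t.tags) :
    t.sortOf L X = L.top := by
  rw [sortOf, dif_neg]
  rintro ⟨s, h, -⟩
  exact hX h.mem_tags

end OSFTerm

/-! ### Degrees of satisfaction and denotations. -/

/-- The degree to which an assignment satisfies a constraint. -/
def Constraint.val {L : FuzzyLattice S} (I : Interpretation L F) (α : V → I.Dom) :
    Constraint S F V → unitInterval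
  | sort X s => I.sort s (α X)
  | eq X Y => if α X = α Y then 1 else 0
  | feat X f Y => if I.feat f (α X) = α Y then 1 else 0

theorem pos_ite {p : Prop} : 0 < (if p then 1 else 0 : unitInterval) ↔ p := by
  split_ifs with h <;> simp [h]

theorem le_ite_of_pos {p : Prop} {γ : unitInterval} (hγ : 0 < γ)
    (h : γ ≤ if p then 1 else 0) : p :=
  pos_ite.1 (hγ.trans_le h)

/-- A finite minimum of positive degrees is positive; this passes from positivity of each constraint
to a common bound `γ`. -/
theorem exists_pos_le {ι : Type*} (m : Multiset ι) (v : ι → unitInterval)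
    (h : ∀ c ∈ m, 0 < v c) : ∃ γ, 0 < γ ∧ ∀ c ∈ m, γ ≤ v c := by
  induction m using Multiset.induction with
  | empty => exact ⟨1, zero_lt_one, by simp⟩
  | cons a m ih =>
    obtain ⟨γ, hγ, hm⟩ := ih fun c hc => h c (Multiset.mem_cons_of_mem hc)
    refine ⟨γ ⊓ v a, lt_inf_iff.2 ⟨hγ, h a (Multiset.mem_cons_self a m)⟩, fun c hc => ?_⟩
    obtain rfl | hc := Multiset.mem_cons.1 hc
    · exact inf_le_right
    · exact inf_le_left.trans (hm c hc)

namespace OSFTerm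

variable {L : FuzzyLattice S}

/-- Comparison with `γ` turns nested minima into a conjunction. When `γ > 0`, the indicator at each
node forces the point reached there to be the value of its tag, so sorts can be tested at tags
instead of along paths. -/
theorem le_denotAt_iff_subterms (I : Interpretation L F) (α : V → I.Dom) (γ : unitInterval)
    (t : OSFTerm S F V) (d : I.Dom) :
    γ ≤ t.denotAt I α d ↔ γ ≤ (if d = α t.root then 1 else 0) ∧
      (∀ r ∈ t.subterms, γ ≤ I.sort r.rootSort (α r.root)) ∧
      ∀ c ∈ t.featClause, γ ≤ c.val I α := by
  by_cases hγ : γ = 0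
  · simp [hγ]
  replace hγ : 0 < γ := pos_iff_ne_zero.2 hγ
  induction t generalizing d with
  | mk X s n f t ih =>
    simp only [denotAt, le_inf_iff, le_iInf_iff, ih, root_mk]
    constructor
    · rintro ⟨⟨h1, h2⟩, h3⟩
      obtain rfl := le_ite_of_pos hγ h1
      refine ⟨h1, fun r hr => ?_, fun c hc => ?_⟩
      · obtain rfl | ⟨i, hr⟩ := mem_subterms_mk.1 hr
        · exact h2
        · exact (h3 i).2.1 r hr
      · obtain ⟨i, rfl | hc⟩ := mem_featClause_mk.1 hc
        · exact (h3 i).1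
        · exact (h3 i).2.2 c hc
    · rintro ⟨h1, h2, h3⟩
      obtain rfl := le_ite_of_pos hγ h1
      exact ⟨⟨h1, h2 _ (mem_subterms_mk.2 (Or.inl rfl))⟩, fun i =>
        ⟨h3 _ (mem_featClause_mk.2 ⟨i, Or.inl rfl⟩),
          fun r hr => h2 r (mem_subterms_mk.2 (Or.inr ⟨i, hr⟩)),
          fun c hc => h3 c (mem_featClause_mk.2 ⟨i, Or.inr hc⟩)⟩⟩

theorem mem_toClause_iff {t : OSFTerm S F V} {c : Constraint S F V} :
    c ∈ t.toClause L ↔ (∃ X ∈ t.tags, c = Constraint.sort X (t.sortOf L X)) ∨ c ∈ t.featClause := by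
  simp [toClause, eq_comm]

/-- The occurrences whose sort the clause does not record have sort `⊤`, hence degree 1, and impose
nothing. -/
theorem IsNormal.le_denotAt_iff {t : OSFTerm S F V} (ht : t.IsNormal L) (I : Interpretation L F)
    (α : V → I.Dom) (γ : unitInterval) (d : I.Dom) :
    γ ≤ t.denotAt I α d ↔ γ ≤ (if d = α t.root then 1 else 0) ∧
      ∀ c ∈ t.toClause L, γ ≤ c.val I α := by
  rw [le_denotAt_iff_subterms]
  refine and_congr_right fun _ => ?_
  constructor
  · rintro ⟨h1, h2⟩ c hc
    obtain ⟨X, hX, rfl⟩ | hc := mem_toClause_iff.1 hc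
    · obtain ⟨r, hr, rfl, hs⟩ := (ht.appears_sortOf hX).1
      have := h1 r hr
      rwa [hs] at this
    · exact h2 c hc
  · intro h
    refine ⟨fun r hr => ?_, fun c hc => h c (mem_toClause_iff.2 (Or.inr hc))⟩
    have hX : r.root ∈ t.tags := mem_tags_iff.2 ⟨r, hr, rfl⟩
    obtain hs | hs := (ht.appears_sortOf hX).2 _ ⟨r, hr, rfl, rfl⟩
    · rw [hs]
      exact h _ (mem_toClause_iff.2 (Or.inl ⟨_, hX, rfl⟩))
    · rw [hs, I.sort_top]
      exact le_top

theorem IsNormal.denotAt_pos_iff {t : OSFTerm S F V} (ht : t.IsNormal L) (I : Interpretation L F)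
    (α : V → I.Dom) (d : I.Dom) :
    0 < t.denotAt I α d ↔ d = α t.root ∧ ∀ c ∈ t.toClause L, 0 < c.val I α := by
  constructor
  · intro h
    obtain ⟨h1, h2⟩ := (ht.le_denotAt_iff I α _ d).1 le_rfl
    exact ⟨le_ite_of_pos h h1, fun c hc => h.trans_le (h2 c hc)⟩
  · rintro ⟨rfl, h⟩
    obtain ⟨γ, hγ, h⟩ := exists_pos_le _ _ h
    refine hγ.trans_le ((ht.le_denotAt_iff I α γ _).2 ⟨?_, h⟩)
    rw [if_pos rfl]
    exact le_top

/-- Feature functions determine an assignment on the tags of a term by its value at the root. -/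
theorem eq_on_tags (I : Interpretation L F) (α β : V → I.Dom) (t : OSFTerm S F V)
    (hα : ∀ c ∈ t.featClause, 0 < c.val I α) (hβ : ∀ c ∈ t.featClause, 0 < c.val I β)
    (h : α t.root = β t.root) : ∀ X ∈ t.tags, α X = β X := by
  induction t with
  | mk Y s n f t ih =>
    intro X hX
    obtain rfl | ⟨i, hX⟩ := mem_tags_mk.1 hX
    · exact h
    · refine ih i (fun c hc => hα c (mem_featClause_mk.2 ⟨i, Or.inr hc⟩))
        (fun c hc => hβ c (mem_featClause_mk.2 ⟨i, Or.inr hc⟩)) ?_ X hX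
      have h1 := pos_ite.1 (hα _ (mem_featClause_mk.2 ⟨i, Or.inl rfl⟩))
      have h2 := pos_ite.1 (hβ _ (mem_featClause_mk.2 ⟨i, Or.inl rfl⟩))
      rw [← h1, ← h2]
      exact congrArg _ h

/-- The t-norm is the idempotent minimum, so the loss `γ` is paid once, whatever the depth of the
term. -/
theorem inf_denotAt_le_of_hom {I J : Interpretation L F} (h : I.Dom → J.Dom) (γ : unitInterval)
    (hf : ∀ f d, h (I.feat f d) = J.feat f (h d)) (hs : ∀ s d, γ ⊓ I.sort s d ≤ J.sort s (h d))
    (α : V → I.Dom) (t : OSFTerm S F V) (d : I.Dom) :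
    γ ⊓ t.denotAt I α d ≤ t.denotAt J (h ∘ α) (h d) := by
  induction t generalizing d with
  | mk X s n f t ih =>
    simp only [denotAt, le_inf_iff, le_iInf_iff]
    refine ⟨⟨?_, ?_⟩, fun i => ?_⟩
    · refine inf_le_right.trans (inf_le_left.trans (inf_le_left.trans ?_))
      split_ifs with h1 h2
      · exact le_rfl
      · exact absurd (congrArg h h1) h2
      · exact bot_le
      · exact le_rfl
    · exact (inf_le_inf_left γ (inf_le_left.trans inf_le_right)).trans (hs s d)
    · rw [← hf]
      exact (inf_le_inf_left γ (inf_le_right.trans (iInf_le _ i))).trans (ih i _)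

/-! ### The canonical interpretation of a normal term. -/

/-- The target of the feature `f` at the tag `X` of a term, if the term has one. -/
def featTarget (t : OSFTerm S F V) (X : V) (f : F) : Option V :=
  if h : ∃ Y, Constraint.feat X f Y ∈ t.featClause then some h.choose else none

theorem mem_of_featTarget {t : OSFTerm S F V} {X Y : V} {f : F} (h : t.featTarget X f = some Y) :
    Constraint.feat X f Y ∈ t.featClause := by
  unfold featTarget at h
  split_ifs at h with h'
  rw [← Option.some.inj h]
  exact h'.choose_spec

theorem IsNormal.featTarget_eq {t : OSFTerm S F V} (ht : t.IsNormal L) {X Y : V} {f : F}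
    (h : Constraint.feat X f Y ∈ t.featClause) : t.featTarget X f = some Y := by
  have h' : ∃ Y, Constraint.feat X f Y ∈ t.featClause := ⟨Y, h⟩
  rw [featTarget, dif_pos h', ht.feat_unique h'.choose_spec h]

/-- The sort of an element of the canonical interpretation. -/
def princ (L : FuzzyLattice S) (t : OSFTerm S F V) : V × List F → S
  | (X, []) => t.sortOf L X
  | (_, _ :: _) => L.top

/-- The features of the canonical interpretation: paths are extended freely where the term has
no argument. -/
def pathFeat (t : OSFTerm S F V) (f : F) : V × List F → V × List F
  | (X, []) => match t.featTarget X f with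
    | some Y => (Y, [])
    | none => (X, [f])
  | (X, g :: w) => (X, f :: g :: w)

theorem IsNormal.princ_ne_bot {t : OSFTerm S F V} (ht : t.IsNormal L) (p : V × List F) :
    t.princ L p ≠ L.bot := by
  obtain ⟨X, _ | ⟨g, w⟩⟩ := p
  · exact ht.sortOf_ne_bot X
  · exact ht.1.top_ne_bot

/-- The canonical interpretation of a normal term. -/
def IsNormal.canon {t : OSFTerm S F V} (ht : t.IsNormal L) : Interpretation L F where
  Dom := V × List F
  sort s p := L.sub (t.princ L p) s
  feat := t.pathFeat
  sort_top _ := L.sub_top _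
  sort_bot p := L.sub_bot_eq_zero (ht.princ_ne_bot p)
  sort_sub _ _ _ := L.sub_trans _ _ _
  sort_meet _ _ _ h := L.sub_meet (lt_inf_iff.1 h).1 (lt_inf_iff.1 h).2

/-- The canonical assignment. -/
def IsNormal.incl {t : OSFTerm S F V} (ht : t.IsNormal L) (X : V) : ht.canon.Dom := (X, [])

theorem IsNormal.one_le_val_incl {t : OSFTerm S F V} (ht : t.IsNormal L) :
    ∀ c ∈ t.toClause L, 1 ≤ c.val ht.canon ht.incl := by
  intro c hc
  obtain ⟨X, -, rfl⟩ | hc := mem_toClause_iff.1 hc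
  · exact (L.sub_refl _).ge
  · obtain ⟨X, s, n, f, u, -, i, rfl⟩ := mem_featClause_iff.1 hc
    have : ht.canon.feat (f i) (ht.incl X) = ht.incl (u i).root := by
      change t.pathFeat (f i) (X, []) = ((u i).root, [])
      simp only [pathFeat, ht.featTarget_eq hc]
    rw [Constraint.val, if_pos this]

/-- The extension of an assignment to the canonical interpretation of a term. -/
def pathExt (I : Interpretation L F) (α : V → I.Dom) : V × List F → I.Dom
  | (X, w) => w.foldr I.feat (α X)

theorem pathExt_pathFeat {t : OSFTerm S F V} (I : Interpretation L F) (α : V → I.Dom)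
    (h : ∀ c ∈ t.featClause, 0 < c.val I α) (f : F) (p : V × List F) :
    pathExt I α (t.pathFeat f p) = I.feat f (pathExt I α p) := by
  obtain ⟨X, _ | ⟨g, w⟩⟩ := p
  · simp only [pathFeat]
    cases hY : t.featTarget X f with
    | none => rfl
    | some Y => exact (pos_ite.1 (h _ (mem_of_featTarget hY))).symm
  · rfl

theorem le_sort_pathExt {t : OSFTerm S F V} (I : Interpretation L F) (α : V → I.Dom)
    {γ : unitInterval} (h : ∀ c ∈ t.toClause L, γ ≤ c.val I α) (p : V × List F) :
    γ ≤ I.sort (t.princ L p) (pathExt I α p) := by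
  obtain ⟨X, _ | ⟨g, w⟩⟩ := p
  · by_cases hX : X ∈ t.tags
    · exact h _ (mem_toClause_iff.2 (Or.inl ⟨X, hX, rfl⟩))
    · simp only [princ, sortOf_of_notMem hX, I.sort_top]
      exact le_top
  · simp only [princ, I.sort_top]
    exact le_top

/-- The extended assignment is a homomorphism up to the loss `γ`: the principal sort of `p` holds at
its image to degree `γ`, and `sort_sub` carries this to every sort above it. -/
theorem IsNormal.inf_denotAt_le_pathExt {t : OSFTerm S F V} (ht : t.IsNormal L)
    (I : Interpretation L F) (α : V → I.Dom) {γ : unitInterval} (hγ : 0 < γ)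
    (h : ∀ c ∈ t.toClause L, γ ≤ c.val I α) (t' : OSFTerm S F V) (α' : V → ht.canon.Dom)
    (p : ht.canon.Dom) :
    γ ⊓ t'.denotAt ht.canon α' p ≤ t'.denotAt I (pathExt I α ∘ α') (pathExt I α p) :=
  inf_denotAt_le_of_hom (I := ht.canon) (J := I) (pathExt I α) γ
    (pathExt_pathFeat I α fun c hc => hγ.trans_le (h c (mem_toClause_iff.2 (Or.inr hc))))
    (fun _ p => (inf_le_inf_right _ (le_sort_pathExt I α h p)).trans (I.sort_sub _ _ _)) α' t' p

/-- Any assignment that gives `t` a positive degree at `d` yields an approximate homomorphism from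
the canonical interpretation sending the canonical root to `d`, with that very degree as the loss.
-/
theorem IsNormal.inf_denot_canon_le {t : OSFTerm S F V} (ht : t.IsNormal L) (t' : OSFTerm S F V)
    (I : Interpretation L F) (d : I.Dom) :
    t.denot I d ⊓ t'.denot ht.canon (ht.incl t.root) ≤ t'.denot I d := by
  simp only [denot, iSup_inf_eq, inf_iSup_eq]
  refine iSup₂_le fun α α' => ?_
  by_cases h0 : t.denotAt I α' d = 0
  · rw [h0]
    exact inf_le_left.trans bot_le
  · have hpos := pos_iff_ne_zero.2 h0
    obtain ⟨h1, h2⟩ := (ht.le_denotAt_iff I α' _ d).1 le_rfl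
    obtain rfl := le_ite_of_pos hpos h1
    exact (ht.inf_denotAt_le_pathExt I α' hpos h2 t' α _).trans
      (le_iSup (fun β => t'.denotAt I β (α' t.root)) (pathExt I α' ∘ α))

theorem IsNormal.denot_canon_self {t : OSFTerm S F V} (ht : t.IsNormal L) :
    t.denot ht.canon (ht.incl t.root) = 1 := by
  refine le_antisymm le_top (le_trans ?_ (le_iSup _ ht.incl))
  refine (ht.le_denotAt_iff _ _ _ _).2 ⟨?_, ht.one_le_val_incl⟩
  rw [if_pos rfl]

/-- Subsumption by a normal term is decided in its canonical interpretation. -/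
theorem IsNormal.sub_eq {t : OSFTerm S F V} (ht : t.IsNormal L) (t' : OSFTerm S F V) :
    sub L t t' = t'.denot ht.canon (ht.incl t.root) := by
  refine le_antisymm (sSup_le fun β hβ => ?_) (le_sSup (ht.inf_denot_canon_le t'))
  -- Test `β` where `t` has degree 1.
  have := hβ ht.canon (ht.incl t.root)
  rwa [ht.denot_canon_self, inf_of_le_right unitInterval.le_one'] at this

/-! ### Antisymmetry of subsumption and uniqueness of unifiers. -/

theorem denot_pos_iff {I : Interpretation L F} {t : OSFTerm S F V} {d : I.Dom} :
    0 < t.denot I d ↔ ∃ α, 0 < t.denotAt I α d :=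
  lt_iSup_iff

/-- The two subsumptions give maps between the canonical interpretations. Their composite fixes the
root of `t'`, hence all its tags, since features propagate the root value. So the sort of each tag
of `t'` and the sort of its image in `t` are below each other to positive degrees, and antisymmetry
of sorts makes them equal. -/
theorem IsNormal.sub_eq_one {t t' : OSFTerm S F V} (ht : t.IsNormal L) (ht' : t'.IsNormal L)
    (h : 0 < sub L t t') (h' : 0 < sub L t' t) : sub L t t' = 1 := by
  rw [ht.sub_eq, denot_pos_iff] at h
  rw [ht'.sub_eq, denot_pos_iff] at h'
  obtain ⟨α, hα⟩ := h
  obtain ⟨α', hα'⟩ := h'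
  obtain ⟨hr, hc⟩ := (ht'.denotAt_pos_iff _ _ _).1 hα
  obtain ⟨hr', hc'⟩ := (ht.denotAt_pos_iff _ _ _).1 hα'
  have hle := ((ht.le_denotAt_iff _ _ _ _).1 (le_refl (t.denotAt ht'.canon α' (ht'.incl t'.root)))).2
  have hroot : pathExt ht'.canon α' (ht.incl t.root) = ht'.incl t'.root := hr'.symm
  have hcomp := (lt_inf_iff.2 ⟨hα', hα⟩).trans_le
    (ht.inf_denotAt_le_pathExt ht'.canon α' hα' hle t' α (ht.incl t.root))
  rw [hroot] at hcomp
  obtain ⟨hr2, hc2⟩ := (ht'.denotAt_pos_iff _ _ _).1 hcomp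
  have hid := eq_on_tags ht'.canon _ ht'.incl t'
    (fun c hc => hc2 c (mem_toClause_iff.2 (Or.inr hc)))
    (fun c hc => zero_lt_one.trans_le (ht'.one_le_val_incl c (mem_toClause_iff.2 (Or.inr hc))))
    hr2.symm
  rw [ht.sub_eq]
  refine le_antisymm le_top (le_trans ?_ (le_iSup _ α))
  refine (ht'.le_denotAt_iff _ _ _ _).2 ⟨by rw [if_pos hr], fun c hcm => ?_⟩
  have hpos := hc c hcm
  obtain ⟨X, hX, rfl⟩ | hcf := mem_toClause_iff.1 hcm
  · have h1 : 0 < L.sub (t.princ L (α X)) (t'.sortOf L X) := hpos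
    have h2 := hα'.trans_le (le_sort_pathExt ht'.canon α' hle (α X))
    have h3 : pathExt ht'.canon α' (α X) = ht'.incl X := hid X hX
    rw [h3] at h2
    have h4 : 0 < L.sub (t'.sortOf L X) (t.princ L (α X)) := h2
    change 1 ≤ L.sub (t.princ L (α X)) (t'.sortOf L X)
    rw [L.sub_antisymm _ _ h1 h4, L.sub_refl]
  · obtain ⟨X, s, n, f, u, -, i, rfl⟩ := mem_featClause_iff.1 hcf
    rw [Constraint.val, if_pos (pos_ite.1 hpos)]

theorem IsNormal.sameDenotation {t t' : OSFTerm S F V} (ht : t.IsNormal L) (ht' : t'.IsNormal L)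
    (h : 0 < sub L t t') (h' : 0 < sub L t' t) : SameDenotation L t t' := by
  intro I d
  have h1 := ht.inf_denot_canon_le t' I d
  have h2 := ht'.inf_denot_canon_le t I d
  rw [← ht.sub_eq, ht.sub_eq_one ht' h h', inf_of_le_left unitInterval.le_one'] at h1
  rw [← ht'.sub_eq, ht'.sub_eq_one ht h' h, inf_of_le_left unitInterval.le_one'] at h2
  exact le_antisymm h1 h2

theorem denot_bot (I : Interpretation L F) (X : V) (d : I.Dom) :
    (sortedVar X L.bot : OSFTerm S F V).denot I d = 0 := by
  refine le_antisymm (iSup_le fun α => ?_) bot_le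
  simp only [sortedVar, denotAt, I.sort_bot]
  exact inf_le_left.trans inf_le_right

theorem sub_of_bot (X : V) (t : OSFTerm S F V) : sub L (sortedVar X L.bot) t = 1 := by
  refine le_antisymm le_top (le_sSup fun I d => ?_)
  rw [denot_bot]
  exact inf_le_left.trans bot_le

theorem IsNormal.sub_bot {t : OSFTerm S F V} (ht : t.IsNormal L) (X : V) :
    sub L t (sortedVar X L.bot) = 0 := by
  rw [ht.sub_eq, denot_bot]

theorem sameDenotation_of_sub_pos {t t' : OSFTerm S F V} (ht : t ∈ latticeTerms L)
    (ht' : t' ∈ latticeTerms L) (h : 0 < sub L t t') (h' : 0 < sub L t' t) :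
    SameDenotation L t t' := by
  obtain ht | ⟨X, rfl⟩ := ht <;> obtain ht' | ⟨X', rfl⟩ := ht'
  · exact ht.sameDenotation ht' h h'
  · rw [ht.sub_bot] at h
    exact absurd h (lt_irrefl _)
  · rw [ht'.sub_bot] at h'
    exact absurd h' (lt_irrefl _)
  · intro I d
    rw [denot_bot, denot_bot]

theorem isUnifier_of_isFuzzyGLB {t₁ t₂ t : OSFTerm S F V}
    (h : IsFuzzyGLB (sub L) (latticeTerms L) {t₁, t₂} t) : IsUnifier L t₁ t₂ t :=
  ⟨h, fun _ h' => sameDenotation_of_sub_pos h'.1 h.1 (h.2.2 _ h'.1 h'.2.1) (h'.2.2 _ h.1 h.2.1)⟩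

end OSFTerm

/-! ### Clauses and what the rules preserve. -/

variable {L : FuzzyLattice S}

theorem Constraint.val_eq_pos {I : Interpretation L F} {α : V → I.Dom} {X Y : V} :
    0 < (eq X Y).val I α ↔ α X = α Y :=
  pos_ite

theorem Constraint.val_rename (I : Interpretation L F) (α : V → I.Dom) (z : V → V)
    (c : Constraint S F V) : (c.rename z).val I α = c.val I (α ∘ z) := by
  cases c <;> rfl

theorem Constraint.val_congr (I : Interpretation L F) {α β : V → I.Dom} {c : Constraint S F V}
    (h : ∀ X ∈ c.tags, α X = β X) : c.val I α = c.val I β := by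
  cases c <;> simp_all [Constraint.val, Constraint.tags]

theorem Constraint.mem_tags_rename {z : V → V} {c : Constraint S F V} {Z : V} :
    Z ∈ (c.rename z).tags ↔ ∃ W ∈ c.tags, z W = Z := by
  cases c <;> simp [Constraint.rename, Constraint.tags, eq_comm]

namespace Clause

theorem hasTag_cons {φ : Clause S F V} {c : Constraint S F V} {Z : V} :
    HasTag (c ::ₘ φ) Z ↔ Z ∈ c.tags ∨ φ.HasTag Z := by
  simp [HasTag]

theorem hasTag_map_rename {φ : Clause S F V} {z : V → V} {Z : V} :
    HasTag (φ.map (Constraint.rename z)) Z ↔ ∃ W, φ.HasTag W ∧ z W = Z := by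
  simp only [HasTag, Multiset.mem_map]
  constructor
  · rintro ⟨_, ⟨c, hc, rfl⟩, h⟩
    obtain ⟨W, hW, rfl⟩ := Constraint.mem_tags_rename.1 h
    exact ⟨W, ⟨c, hc, hW⟩, rfl⟩
  · rintro ⟨W, ⟨c, hc, hW⟩, rfl⟩
    exact ⟨_, ⟨c, hc, rfl⟩, Constraint.mem_tags_rename.2 ⟨W, hW, rfl⟩⟩

theorem TagEquiv.symm {φ : Clause S F V} {X Y : V} (h : φ.TagEquiv X Y) : φ.TagEquiv Y X := by
  induction h with
  | refl => exact .refl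
  | tail _ h ih => exact .head h.symm ih

theorem tagEquiv_of_mem {φ : Clause S F V} {X Y : V} (h : Constraint.eq X Y ∈ φ) :
    φ.TagEquiv X Y :=
  .single (Or.inl h)

theorem TagEquiv.map {φ φ' : Clause S F V} (H : ∀ X Y, Constraint.eq X Y ∈ φ → φ'.TagEquiv X Y)
    {X Y : V} (h : φ.TagEquiv X Y) : φ'.TagEquiv X Y := by
  induction h with
  | refl => exact .refl
  | tail _ h ih => exact ih.trans (h.elim (H _ _) fun h => (H _ _ h).symm)

/-- The clause `φ'` has the same tags as `φ`, and all constraints of `φ`, up to the equalities of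
`φ'` and up to a change of sorts. -/
structure Refines (φ φ' : Clause S F V) : Prop where
  tag : ∀ Z, φ'.HasTag Z ↔ φ.HasTag Z
  equiv : ∀ X Y, Constraint.eq X Y ∈ φ → φ'.TagEquiv X Y
  sort : ∀ X s, Constraint.sort X s ∈ φ → ∃ X' s', φ'.TagEquiv X X' ∧ Constraint.sort X' s' ∈ φ'
  feat : ∀ X f Y, Constraint.feat X f Y ∈ φ →
    ∃ X' Y', φ'.TagEquiv X X' ∧ Constraint.feat X' f Y' ∈ φ' ∧ φ'.TagEquiv Y' Y

theorem Refines.refl (φ : Clause S F V) : φ.Refines φ :=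
  ⟨fun _ => Iff.rfl, fun _ _ => tagEquiv_of_mem, fun X s h => ⟨X, s, .refl, h⟩,
    fun X _ Y h => ⟨X, Y, .refl, h, .refl⟩⟩

theorem Refines.trans {φ φ' φ'' : Clause S F V} (h : φ.Refines φ') (h' : φ'.Refines φ'') :
    φ.Refines φ'' where
  tag Z := (h'.tag Z).trans (h.tag Z)
  equiv X Y hXY := (h.equiv X Y hXY).map h'.equiv
  sort X s hX := by
    obtain ⟨X', s', hXX, hX'⟩ := h.sort X s hX
    obtain ⟨X'', s'', hXX', hX''⟩ := h'.sort X' s' hX'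
    exact ⟨X'', s'', (hXX.map h'.equiv).trans hXX', hX''⟩
  feat X f Y hX := by
    obtain ⟨X', Y', hXX, hX', hYY⟩ := h.feat X f Y hX
    obtain ⟨X'', Y'', hXX', hX'', hYY'⟩ := h'.feat X' f Y' hX'
    exact ⟨X'', Y'', (hXX.map h'.equiv).trans hXX', hX'', hYY'.trans (hYY.map h'.equiv)⟩

end Clause

/-- Only Inconsistent Sort discards information. The other rules replace a constraint by one that
represents it modulo the equalities kept in the clause. -/
theorem Step.refines {φ φ' : Clause S F V} (h : Step L φ φ') :
    (∃ X, φ' = {Constraint.sort X L.bot}) ∨ φ.Refines φ' := by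
  cases h with
  | sortIntersection φ X s s' =>
    right
    constructor
    · intro Z
      simp [Clause.hasTag_cons, Constraint.tags]
    · intro U W h
      exact Clause.tagEquiv_of_mem (by simpa using h)
    · intro U t h
      by_cases hU : U = X
      · exact ⟨X, _, hU ▸ .refl, Multiset.mem_cons_self _ _⟩
      · exact ⟨U, t, .refl, by simpa [hU] using h⟩
    · intro U g W h
      exact ⟨U, W, .refl, by simpa using h, .refl⟩
  | featureFunctionality φ X f Y Y' =>
    right
    constructor
    · intro Z
      simp only [Clause.hasTag_cons, Constraint.tags, Finset.mem_insert, Finset.mem_singleton]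
      tauto
    · intro U W h
      refine Clause.tagEquiv_of_mem ?_
      simp only [Multiset.mem_cons, reduceCtorEq, false_or] at h
      simp [h]
    · intro U t h
      exact ⟨U, t, .refl, by simpa using h⟩
    · intro U g W h
      -- The removed constraint is represented by `X.f ≐ Y`, thanks to the new equality `Y ≐ Y'`.
      by_cases h' : (Constraint.feat U g W : Constraint S F V) = Constraint.feat X f Y'
      · cases h'
        exact ⟨_, Y, .refl, Multiset.mem_cons_self _ _, Clause.tagEquiv_of_mem (by simp)⟩
      · refine ⟨U, W, .refl, ?_, .refl⟩
        rw [Multiset.mem_cons, Multiset.mem_cons] at h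
        rw [Multiset.mem_cons, Multiset.mem_cons]
        tauto
  | inconsistentSort φ X hφ => exact Or.inl ⟨X, rfl⟩
  | tagElimination φ X Y hXY hY =>
    right
    -- The rule keeps `X ≐ Y`, so substitution moves each tag within its class.
    have hρ : ∀ U, Clause.TagEquiv (Constraint.eq X Y ::ₘ φ.subst X Y) U
        (if U = Y then X else U) := by
      intro U
      split_ifs with h
      · rw [h]
        exact (Clause.tagEquiv_of_mem (Multiset.mem_cons_self _ _)).symm
      · exact .refl
    have hmem : ∀ c ∈ φ, c.rename (fun W => if W = Y then X else W) ∈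
        Constraint.eq X Y ::ₘ φ.subst X Y := fun c hc =>
      Multiset.mem_cons_of_mem (Multiset.mem_map_of_mem _ hc)
    constructor
    · intro Z
      simp only [Clause.hasTag_cons, Clause.subst, Clause.hasTag_map_rename, Constraint.tags,
        Finset.mem_insert, Finset.mem_singleton]
      constructor
      · rintro ((rfl | rfl) | ⟨W, hW, rfl⟩)
        · simp
        · simp
        · split_ifs <;> tauto
      · rintro ((rfl | rfl) | hZ)
        · simp
        · simp
        · by_cases h : Z = Y
          · exact Or.inl (Or.inr h)
          · exact Or.inr ⟨Z, hZ, if_neg h⟩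
    · intro U W h
      obtain h | h := Multiset.mem_cons.1 h
      · exact Clause.tagEquiv_of_mem (Multiset.mem_cons.2 (Or.inl h))
      · exact ((hρ U).trans (Clause.tagEquiv_of_mem (hmem _ h))).trans (hρ W).symm
    · intro U t h
      have h : Constraint.sort U t ∈ φ := by simpa using h
      exact ⟨_, t, hρ U, hmem _ h⟩
    · intro U g W h
      have h : Constraint.feat U g W ∈ φ := by simpa using h
      exact ⟨_, _, hρ U, hmem _ h, (hρ W).symm⟩

/-- A run that reaches inconsistency must stop there. Hence a run ending in another clause used only
rules that refine. -/
theorem not_step_singleton_bot (X : V) (φ : Clause S F V) :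
    ¬ Step L {Constraint.sort X L.bot} φ := by
  intro h
  generalize hψ : ({Constraint.sort X L.bot} : Clause S F V) = ψ at h
  cases h with
  | inconsistentSort φ Y hφ =>
    exact hφ (Multiset.card_eq_zero.1 (by simpa using (congrArg Multiset.card hψ).symm))
  | tagElimination φ U W hUW hW =>
    have : Constraint.eq U W ∈ ({Constraint.sort X L.bot} : Clause S F V) := by simp [hψ]
    simp at this
  | _ => simpa using congrArg Multiset.card hψ

theorem Clause.Refines.of_reflTransGen {φ φ' : Clause S F V} (h : Relation.ReflTransGen (Step L) φ φ') :
    (∃ X, φ' = {Constraint.sort X L.bot}) ∨ φ.Refines φ' := by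
  induction h with
  | refl => exact Or.inr (.refl _)
  | tail _ hs ih =>
    obtain ⟨X, rfl⟩ | ih := ih
    · exact absurd hs (not_step_singleton_bot X _)
    · exact hs.refines.imp id ih.trans

/-- The rules preserve and reflect satisfaction to a positive degree. -/
theorem Step.pos_iff {φ φ' : Clause S F V} (h : Step L φ φ') (I : Interpretation L F)
    (α : V → I.Dom) : (∀ c ∈ φ, 0 < c.val I α) ↔ ∀ c ∈ φ', 0 < c.val I α := by
  cases h with
  | sortIntersection φ X s s' =>
    simp only [Multiset.forall_mem_cons, Constraint.val, ← and_assoc]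
    -- Only positivity passes to the meet: `sort_meet` gives no lower bound on its degree.
    refine and_congr_left fun _ => ⟨fun h => I.sort_meet _ _ _ (lt_inf_iff.2 h), fun h => ?_⟩
    exact ⟨(lt_inf_iff.2 ⟨h, L.meet_sub_left s s'⟩).trans_le (I.sort_sub _ _ _),
      (lt_inf_iff.2 ⟨h, L.meet_sub_right s s'⟩).trans_le (I.sort_sub _ _ _)⟩
  | featureFunctionality φ X f Y Y' =>
    simp only [Multiset.forall_mem_cons, Constraint.val, pos_ite, ← and_assoc]
    refine and_congr_left fun _ => and_congr_right fun h => ?_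
    rw [h]
  | inconsistentSort φ X hφ =>
    simp [Constraint.val, I.sort_bot]
  | tagElimination φ X Y hXY hY =>
    simp only [Multiset.forall_mem_cons, Constraint.val_eq_pos, Clause.subst,
      Multiset.forall_mem_map_iff, Constraint.val_rename]
    refine and_congr_right fun h => ?_
    -- An assignment with equal values at `X` and `Y` does not see the substitution.
    have : (α ∘ fun W => if W = Y then X else W) = α := by
      funext W
      simp only [Function.comp]
      split_ifs with hW
      · rw [h, hW]
      · rfl
    rw [this]

theorem pos_iff_of_reflTransGen {φ φ' : Clause S F V} (h : Relation.ReflTransGen (Step L) φ φ')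
    (I : Interpretation L F) (α : V → I.Dom) :
    (∀ c ∈ φ, 0 < c.val I α) ↔ ∀ c ∈ φ', 0 < c.val I α := by
  induction h with
  | refl => rfl
  | tail _ hs ih => exact ih.trans (hs.pos_iff I α)

theorem pos_initialClause_iff {ψ₁ ψ₂ : OSFTerm S F V} (I : Interpretation L F) (α : V → I.Dom) :
    (∀ c ∈ initialClause L ψ₁ ψ₂, 0 < c.val I α) ↔
      ((∀ c ∈ ψ₁.toClause L, 0 < c.val I α) ∧ ∀ c ∈ ψ₂.toClause L, 0 < c.val I α) ∧
        α ψ₁.root = α ψ₂.root := by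
  simp only [initialClause, Multiset.mem_add, Multiset.mem_singleton, or_imp, forall_and,
    forall_eq, Constraint.val, pos_ite]

theorem hasTag_initialClause_iff {ψ₁ ψ₂ : OSFTerm S F V} {X : V} :
    (initialClause L ψ₁ ψ₂).HasTag X ↔ X ∈ ψ₁.tags ∨ X ∈ ψ₂.tags := by
  have key : ∀ ψ : OSFTerm S F V, (∃ c ∈ ψ.toClause L, X ∈ c.tags) ↔ X ∈ ψ.tags := fun ψ => by
    constructor
    · rintro ⟨c, hc, hX⟩
      obtain ⟨Y, hY, rfl⟩ | hc := OSFTerm.mem_toClause_iff.1 hc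
      · simp only [Constraint.tags, Finset.mem_singleton] at hX
        exact hX ▸ hY
      · obtain ⟨Y, s, n, f, u, -, i, rfl⟩ := OSFTerm.mem_featClause_iff.1 hc
        simp only [Constraint.tags, Finset.mem_insert, Finset.mem_singleton] at hX
        obtain rfl | rfl := hX
        · exact (OSFTerm.featClause_tags hc).1
        · exact (OSFTerm.featClause_tags hc).2
    · intro hX
      exact ⟨_, OSFTerm.mem_toClause_iff.2 (Or.inl ⟨X, hX, rfl⟩), by simp [Constraint.tags]⟩
  simp only [Clause.HasTag, initialClause, Multiset.mem_add, Multiset.mem_singleton, or_and_right,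
    exists_or, key, exists_eq_left]
  constructor
  · rintro (h | h)
    · exact h
    simp only [Constraint.tags, Finset.mem_insert, Finset.mem_singleton] at h
    obtain rfl | rfl := h
    · exact Or.inl (OSFTerm.root_mem_tags _)
    · exact Or.inr (OSFTerm.root_mem_tags _)
  · exact Or.inl

/-! ### Correctness of the returned pair. -/

/-- A common positive instance of two normal terms without common tags satisfies every clause
derived from them. -/
theorem exists_pos_of_denot_pos {ψ₁ ψ₂ : OSFTerm S F V} (h₁ : ψ₁.IsNormal L) (h₂ : ψ₂.IsNormal L)
    (hdisj : Disjoint ψ₁.tags ψ₂.tags) {φ : Clause S F V}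
    (hφ : Relation.ReflTransGen (Step L) (initialClause L ψ₁ ψ₂) φ) {I : Interpretation L F}
    {d : I.Dom} (hd₁ : 0 < ψ₁.denot I d) (hd₂ : 0 < ψ₂.denot I d) :
    ∃ α : V → I.Dom, α ψ₁.root = d ∧ ∀ c ∈ φ, 0 < c.val I α := by
  obtain ⟨α₁, hα₁⟩ := OSFTerm.denot_pos_iff.1 hd₁
  obtain ⟨α₂, hα₂⟩ := OSFTerm.denot_pos_iff.1 hd₂
  obtain ⟨rfl, hc₁⟩ := (h₁.denotAt_pos_iff _ _ _).1 hα₁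
  obtain ⟨hr, hc₂⟩ := (h₂.denotAt_pos_iff _ _ _).1 hα₂
  have htags : ∀ (ψ : OSFTerm S F V), ∀ c ∈ ψ.toClause L, ∀ X ∈ c.tags, X ∈ ψ.tags := by
    intro ψ c hc X hX
    -- The tags of one term are obtained from the result on pairs, used with both terms equal to
    -- `ψ`.
    simpa using (hasTag_initialClause_iff (L := L) (ψ₁ := ψ) (ψ₂ := ψ)).1
      ⟨c, by simp [initialClause, hc], hX⟩
  -- Disjointness lets the two assignments be glued; both send their root to the same point, so the
  -- root equality holds as well.
  let α : V → I.Dom := fun X => if X ∈ ψ₁.tags then α₁ X else α₂ X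
  have e₁ : ∀ X ∈ ψ₁.tags, α X = α₁ X := fun X hX => if_pos hX
  have e₂ : ∀ X ∈ ψ₂.tags, α X = α₂ X := fun X hX => if_neg (Finset.disjoint_right.1 hdisj hX)
  refine ⟨α, e₁ _ (OSFTerm.root_mem_tags _), (pos_iff_of_reflTransGen hφ I α).1 ?_⟩
  refine (pos_initialClause_iff I α).2 ⟨⟨fun c hc => ?_, fun c hc => ?_⟩, ?_⟩
  · rw [Constraint.val_congr I fun X hX => e₁ X (htags _ c hc X hX)]
    exact hc₁ c hc
  · rw [Constraint.val_congr I fun X hX => e₂ X (htags _ c hc X hX)]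
    exact hc₂ c hc
  · rw [e₁ _ (OSFTerm.root_mem_tags _), e₂ _ (OSFTerm.root_mem_tags _), hr]

namespace OSFTerm

/-- The subsumption degree of two normal terms related by a tag map. -/
theorem IsNormal.sub_eq_tagDegree {ψ ψ' : OSFTerm S F V} (hψ : ψ.IsNormal L) (hψ' : ψ'.IsNormal L)
    (z : V → V) (hr : ψ.root = z ψ'.root)
    (hz : ∀ c ∈ ψ'.toClause L, 0 < c.val hψ.canon (hψ.incl ∘ z)) :
    sub L ψ ψ' = tagDegree L ψ ψ' z ∧ 0 < sub L ψ ψ' := by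
  have hroot : hψ.incl ψ.root = (hψ.incl ∘ z) ψ'.root := congrArg hψ.incl hr
  rw [hψ.sub_eq]
  refine ⟨le_antisymm (iSup_le fun α => ?_) ((le_trans ?_ (le_iSup _ (hψ.incl ∘ z)))),
    denot_pos_iff.2 ⟨_, (hψ'.denotAt_pos_iff _ _ _).2 ⟨hroot, hz⟩⟩⟩
  · by_cases h0 : ψ'.denotAt hψ.canon α (hψ.incl ψ.root) = 0
    · rw [h0]; exact bot_le
    · obtain ⟨h1, h2⟩ := (hψ'.denotAt_pos_iff _ _ _).1 (pos_iff_ne_zero.2 h0)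
      -- Every assignment of nonzero value agrees with `hψ.incl ∘ z` on the tags, so the supremum
      -- reduces to the value of that assignment.
      have hα := eq_on_tags hψ.canon α (hψ.incl ∘ z) ψ'
        (fun c hc => h2 c (mem_toClause_iff.2 (Or.inr hc)))
        (fun c hc => hz c (mem_toClause_iff.2 (Or.inr hc))) (h1.symm.trans hroot)
      refine Finset.le_inf fun X hX => ?_
      have h3 := ((hψ'.le_denotAt_iff hψ.canon α _ (hψ.incl ψ.root)).1 le_rfl).2 _
        (mem_toClause_iff.2 (Or.inl ⟨X, hX, rfl⟩))
      rw [Constraint.val, hα X hX] at h3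
      exact h3
  · refine (hψ'.le_denotAt_iff _ _ _ _).2 ⟨?_, fun c hc => ?_⟩
    · rw [if_pos hroot]; exact le_top
    · have hpos := hz c hc
      obtain ⟨X, hX, rfl⟩ | hc := mem_toClause_iff.1 hc
      · exact Finset.inf_le hX
      · obtain ⟨X, s, n, f, u, -, i, rfl⟩ := mem_featClause_iff.1 hc
        rw [Constraint.val, if_pos (pos_ite.1 hpos)]
        exact le_top

end OSFTerm

theorem Clause.TagEquiv.eq_of_pos {φ : Clause S F V} {I : Interpretation L F} {α : V → I.Dom}
    (h : ∀ c ∈ φ, 0 < c.val I α) {X Y : V} (hXY : φ.TagEquiv X Y) : α X = α Y := by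
  induction hXY with
  | refl => rfl
  | tail _ hs ih =>
    rw [ih]
    exact hs.elim (fun hs => pos_ite.1 (h _ hs)) fun hs => (pos_ite.1 (h _ hs)).symm

/-- Solutions travel in both directions. The canonical solution of `ψ` is pulled back along the run
to show that `ψ` is a lower bound and to compute the degree; a solution given by a lower bound `y`
is pushed forward along the run and then descends to the classes of tags, so `y` is below `ψ`. An
inconsistent final clause has no solution, so only bottom terms are lower bounds. -/
theorem UnifyOutput.isUnifierWithDegree {ψ₁ ψ₂ ψ : OSFTerm S F V} {β : unitInterval}
    (h₁ : ψ₁.IsNormal L) (h₂ : ψ₂.IsNormal L) (hdisj : Disjoint ψ₁.tags ψ₂.tags)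
    (h : UnifyOutput L ψ₁ ψ₂ ψ β) : OSFTerm.IsUnifierWithDegree L ψ₁ ψ₂ ψ β := by
  obtain ⟨φ, ⟨hφ, -⟩, ⟨X, rfl, rfl, rfl⟩ | ⟨hcons, z, hz, hψ, hroot, hclause, rfl⟩⟩ := h
  · refine ⟨OSFTerm.isUnifier_of_isFuzzyGLB ⟨Or.inr ⟨X, rfl⟩, fun t _ => ?_, fun y hy hy' => ?_⟩, ?_⟩
    · rw [OSFTerm.sub_of_bot]; exact zero_lt_one
    · obtain hy | ⟨Y, rfl⟩ := hy
      · have hy₁ := hy' ψ₁ (by simp)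
        have hy₂ := hy' ψ₂ (by simp)
        rw [hy.sub_eq] at hy₁ hy₂
        obtain ⟨α, -, hα⟩ := exists_pos_of_denot_pos h₁ h₂ hdisj hφ hy₁ hy₂
        have := hα _ (Multiset.mem_singleton_self _)
        rw [Constraint.val, Interpretation.sort_bot] at this
        exact absurd this (lt_irrefl _)
      · rw [OSFTerm.sub_of_bot]; exact zero_lt_one
    · rw [OSFTerm.sub_of_bot, OSFTerm.sub_of_bot, inf_idem]
  -- Equalities hold because `z` identifies equivalent tags; the other constraints become
  -- constraints of `ψ`, which its canonical assignment satisfies.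
  · have hpos : ∀ c ∈ φ, 0 < c.val hψ.canon (hψ.incl ∘ z) := by
      intro c hc
      cases c with
      | eq X Y =>
        refine pos_ite.2 (congrArg hψ.incl ?_)
        refine ((hz X ⟨_, hc, by simp [Constraint.tags]⟩).2 Y ⟨_, hc, by simp [Constraint.tags]⟩).2 ?_
        exact Clause.tagEquiv_of_mem hc
      | _ =>
        rw [← Constraint.val_rename]
        refine zero_lt_one.trans_le (hψ.one_le_val_incl _ ?_)
        rw [hclause]
        exact Multiset.mem_map_of_mem _ (Multiset.mem_filter.2 ⟨hc, trivial⟩)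
    obtain ⟨⟨hp₁, hp₂⟩, hr⟩ := (pos_initialClause_iff _ _).1 ((pos_iff_of_reflTransGen hφ _ _).2 hpos)
    have hr' : z ψ₁.root = z ψ₂.root := congrArg Prod.fst hr
    obtain ⟨e₁, hs₁⟩ := hψ.sub_eq_tagDegree h₁ z hroot hp₁
    obtain ⟨e₂, hs₂⟩ := hψ.sub_eq_tagDegree h₂ z (hroot.trans hr') hp₂
    refine ⟨OSFTerm.isUnifier_of_isFuzzyGLB ⟨Or.inl hψ, ?_, fun y hy hy' => ?_⟩, by rw [e₁, e₂]⟩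
    · rintro t (rfl | rfl)
      · exact hs₁
      · exact hs₂
    · obtain hy | ⟨Y, rfl⟩ := hy
      swap
      · rw [OSFTerm.sub_of_bot]; exact zero_lt_one
      have hy₁ := hy' ψ₁ (by simp)
      have hy₂ := hy' ψ₂ (by simp)
      rw [hy.sub_eq] at hy₁ hy₂ ⊢
      obtain ⟨α, hαr, hα⟩ := exists_pos_of_denot_pos h₁ h₂ hdisj hφ hy₁ hy₂
      have hRef := (Clause.Refines.of_reflTransGen hφ).resolve_left hcons
      have hroottag : φ.HasTag ψ₁.root :=
        (hRef.tag _).2 (hasTag_initialClause_iff.2 (Or.inl (OSFTerm.root_mem_tags _)))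
      -- The solution descends along `z`: it is constant on classes because it satisfies the
      -- equalities. The value outside the image of `z` plays no role.
      let α' : V → hy.canon.Dom := fun Z =>
        if h : ∃ X, φ.HasTag X ∧ z X = Z then α h.choose else hy.incl Z
      have hα' : ∀ X, φ.HasTag X → α' (z X) = α X := by
        intro X hX
        have h : ∃ X', φ.HasTag X' ∧ z X' = z X := ⟨X, hX, rfl⟩
        have e : α' (z X) = α h.choose := dif_pos h
        rw [e]
        exact (((hz _ h.choose_spec.1).2 X hX).1 h.choose_spec.2).eq_of_pos hα
      refine OSFTerm.denot_pos_iff.2 ⟨α', (hψ.denotAt_pos_iff _ _ _).2 ⟨?_, fun c hc => ?_⟩⟩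
      · rw [hroot, hα' _ hroottag, hαr]
      · rw [hclause] at hc
        obtain ⟨c, hcs, rfl⟩ := Multiset.mem_map.1 hc
        have hcφ := Multiset.mem_of_mem_filter hcs
        rw [Constraint.val_rename, Constraint.val_congr (α := α' ∘ z) _ fun X hX => hα' X ⟨c, hcφ, hX⟩]
        exact hα c hcφ

/-! ### Termination. -/

/-- The occurrences of tags in a constraint. -/
def Constraint.occurrences : Constraint S F V → Multiset V
  | sort X _ => {X}
  | eq X Y => {X, Y}
  | feat X _ Y => {X, Y}

theorem Constraint.mem_occurrences {c : Constraint S F V} {X : V} :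
    X ∈ c.occurrences ↔ X ∈ c.tags := by
  cases c <;> simp [occurrences, tags]

theorem Constraint.occurrences_rename (z : V → V) (c : Constraint S F V) :
    (c.rename z).occurrences = c.occurrences.map z := by
  cases c <;> simp [occurrences, rename]

namespace Clause

/-- The occurrences of tags in a clause. -/
def occurrences (φ : Clause S F V) : Multiset V := φ.bind Constraint.occurrences

theorem mem_occurrences {φ : Clause S F V} {X : V} : X ∈ φ.occurrences ↔ φ.HasTag X := by
  simp [occurrences, HasTag, Constraint.mem_occurrences]

theorem occurrences_cons (c : Constraint S F V) (φ : Clause S F V) :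
    occurrences (c ::ₘ φ) = c.occurrences + φ.occurrences :=
  Multiset.cons_bind _ _ _

theorem occurrences_map_rename (φ : Clause S F V) (z : V → V) :
    occurrences (φ.map (Constraint.rename z)) = φ.occurrences.map z := by
  simp [occurrences, Multiset.bind_map, Multiset.map_bind, Constraint.occurrences_rename]

theorem one_le_count_of_mem {φ : Clause S F V} {c : Constraint S F V} {X : V} (hc : c ∈ φ)
    (hX : X ∈ c.tags) : 1 ≤ φ.occurrences.count X :=
  Multiset.one_le_count_iff_mem.2 (mem_occurrences.2 ⟨c, hc, hX⟩)

theorem solved_cons_sort (φ : Clause S F V) (X : V) (s : S) :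
    solved (Constraint.sort X s ::ₘ φ) = Constraint.sort X s ::ₘ φ.solved :=
  Multiset.filter_cons_of_pos _ trivial

theorem solved_cons_feat (φ : Clause S F V) (X : V) (f : F) (Y : V) :
    solved (Constraint.feat X f Y ::ₘ φ) = Constraint.feat X f Y ::ₘ φ.solved :=
  Multiset.filter_cons_of_pos _ trivial

theorem solved_cons_eq (φ : Clause S F V) (X Y : V) :
    solved (Constraint.eq X Y ::ₘ φ) = φ.solved :=
  Multiset.filter_cons_of_neg _ id

/-- The only occurrence of `Y` is as the right-hand side of an equality. -/
def Eliminated (φ : Clause S F V) (Y : V) : Prop :=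
  φ.occurrences.count Y ≤ 1 ∧ ∃ X, X ≠ Y ∧ Constraint.eq X Y ∈ φ

/-- The tags that have not been eliminated. -/
def live (φ : Clause S F V) : Finset V := φ.occurrences.toFinset.filter fun X => ¬ φ.Eliminated X

theorem mem_live {φ : Clause S F V} {X : V} : X ∈ φ.live ↔ φ.HasTag X ∧ ¬ φ.Eliminated X := by
  simp [live, mem_occurrences]

/-- The quantity that decreases along the rules. -/
def weight (φ : Clause S F V) : ℕ :=
  φ.live.card + φ.solved.card + Multiset.card φ

end Clause

open Clause in
-- No summand ever grows. The two merging rules lower the number of constraints that are not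
-- equalities, Inconsistent Sort lowers the total number, and Tag Elimination lowers the number of
-- live tags alone. The point to check is that an eliminated tag stays eliminated: its one
-- occurrence is used up by its equality, so no rule can touch it elsewhere.
theorem Step.weight_lt {φ φ' : Clause S F V} (h : Step L φ φ') : φ'.weight < φ.weight := by
  cases h with
  | sortIntersection φ X s s' =>
    have hlive : live (Constraint.sort X (L.meet s s') ::ₘ φ) ⊆
        live (Constraint.sort X s ::ₘ Constraint.sort X s' ::ₘ φ) := by
      intro W
      simp only [mem_live, hasTag_cons]
      refine And.imp (by rintro (h | h) <;> simp_all [Constraint.tags]) (mt ?_)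
      rintro ⟨h, U, hU, hm⟩
      refine ⟨?_, U, hU, by simpa using hm⟩
      simp only [occurrences_cons, Multiset.count_add, Constraint.occurrences] at h ⊢
      omega
    have := Finset.card_le_card hlive
    simp only [weight, solved_cons_sort, Multiset.card_cons]
    omega
  | featureFunctionality φ X f Y Y' =>
    have hlive : live (Constraint.feat X f Y ::ₘ Constraint.eq Y Y' ::ₘ φ) ⊆
        live (Constraint.feat X f Y ::ₘ Constraint.feat X f Y' ::ₘ φ) := by
      intro W
      simp only [mem_live, hasTag_cons]
      refine And.imp (by rintro (h | h | h) <;> simp_all [Constraint.tags]; tauto) (mt ?_)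
      rintro ⟨h, U, hU, hm⟩
      refine ⟨?_, U, hU, ?_⟩
      · have hm : Constraint.eq U W ∈ φ := by simpa using hm
        -- The equality in `φ` uses the only occurrence of `W`, which therefore differs from `X`,
        -- `Y` and `Y'`.
        have := one_le_count_of_mem (X := W) hm (by simp [Constraint.tags])
        simp only [occurrences_cons, Multiset.count_add, Constraint.occurrences,
          Multiset.insert_eq_cons, Multiset.count_cons, Multiset.count_singleton] at h ⊢
        split_ifs at h ⊢ <;> omega
      · have hm : Constraint.eq U W ∈ φ := by simpa using hm
        simp [hm]
    have := Finset.card_le_card hlive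
    simp only [weight, solved_cons_feat, solved_cons_eq, Multiset.card_cons]
    omega
  | inconsistentSort φ X hφ =>
    have hlive : live {(Constraint.sort X L.bot : Constraint S F V)} ⊆
        live (Constraint.sort X L.bot ::ₘ φ) := by
      intro W
      simp only [mem_live, hasTag_cons]
      rintro ⟨⟨c, hc, hW⟩, -⟩
      rw [Multiset.mem_singleton] at hc
      subst hc
      refine ⟨Or.inl hW, ?_⟩
      rintro ⟨h, U, hU, hm⟩
      have hm : Constraint.eq U W ∈ φ := by simpa using hm
      have h1 := one_le_count_of_mem (X := W) hm (by simp [Constraint.tags])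
      have h2 := Multiset.one_le_count_iff_mem.2 (Constraint.mem_occurrences.2 hW)
      rw [occurrences_cons, Multiset.count_add] at h
      omega
    have := Finset.card_le_card hlive
    have hpos := Multiset.card_pos.2 hφ
    have hs : solved {(Constraint.sort X L.bot : Constraint S F V)} = {Constraint.sort X L.bot} :=
      Multiset.filter_eq_self.2 (by simp [Constraint.NotEq])
    rw [weight, hs]
    simp only [weight, solved_cons_sort, Multiset.card_singleton,
      Multiset.card_cons]
    omega
  | tagElimination φ X Y hXY hY =>
    have hcY : 2 ≤ (occurrences (Constraint.eq X Y ::ₘ φ)).count Y := by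
      have := Multiset.one_le_count_iff_mem.2 (mem_occurrences.2 hY)
      simp only [occurrences_cons, Multiset.count_add, Constraint.occurrences,
        Multiset.insert_eq_cons, Multiset.count_cons, Multiset.count_singleton, if_true]
      omega
    have hocc : occurrences (φ.subst X Y) = φ.occurrences.map fun W => if W = Y then X else W :=
      occurrences_map_rename _ _
    have hYs : ¬ (φ.subst X Y).HasTag Y := by
      rw [← mem_occurrences, hocc, Multiset.mem_map]
      rintro ⟨W, -, hW⟩
      split_ifs at hW with h
      · exact hXY hW
      · exact h hW
    -- The tag `Y` witnesses strictness: it occurred at least twice, and afterwards only in `X ≐ Y`.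
    have hlive : live (Constraint.eq X Y ::ₘ φ.subst X Y) ⊂ live (Constraint.eq X Y ::ₘ φ) := by
      refine (Finset.ssubset_iff_of_subset ?_).2 ⟨Y, ?_, ?_⟩
      · intro W
        simp only [mem_live]
        refine And.imp ?_ (mt ?_)
        · simp only [hasTag_cons, subst, hasTag_map_rename]
          rintro (h | ⟨U, hU, rfl⟩)
          · exact Or.inl h
          · split_ifs
            · exact Or.inl (by simp [Constraint.tags])
            · exact Or.inr hU
        · rintro ⟨h, U, hU, hm⟩
          have hWY : W ≠ Y := by rintro rfl; omega
          have hm : Constraint.eq U W ∈ φ := by simpa [hWY] using hm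
          have h1 := one_le_count_of_mem (X := W) hm (by simp [Constraint.tags])
          -- Otherwise `W` would occur both in the equality `X ≐ Y` and in `φ`.
          have hWX : W ≠ X := by
            rintro rfl
            simp only [occurrences_cons, Multiset.count_add, Constraint.occurrences,
              Multiset.insert_eq_cons, Multiset.count_cons, Multiset.count_singleton,
              if_true] at h
            omega
          refine ⟨?_, if U = Y then X else U, ?_, ?_⟩
          · have : (occurrences (φ.subst X Y)).count W = φ.occurrences.count W := by
              rw [hocc, Multiset.count_map, Multiset.count, Multiset.countP_eq_card_filter]
              congr 1
              refine Multiset.filter_congr fun Z _ => ?_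
              split_ifs with hZ
              · exact iff_of_false hWX (hZ ▸ hWY)
              · rfl
            rw [occurrences_cons, Multiset.count_add] at h ⊢
            omega
          · split_ifs
            · exact hWX.symm
            · exact hU
          · refine Multiset.mem_cons_of_mem (Multiset.mem_map.2 ⟨_, hm, ?_⟩)
            simp [Constraint.rename, hWY]
      · refine mem_live.2 ⟨hasTag_cons.2 (Or.inr hY), ?_⟩
        rintro ⟨h, -⟩
        omega
      · rw [mem_live, not_and, not_not]
        refine fun _ => ⟨?_, X, hXY, Multiset.mem_cons_self _ _⟩
        rw [occurrences_cons, Multiset.count_add,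
          Multiset.count_eq_zero_of_notMem (mt mem_occurrences.1 hYs)]
        simp [Constraint.occurrences, hXY.symm]
    have := Finset.card_lt_card hlive
    have hs : Multiset.card (solved (φ.subst X Y)) = Multiset.card φ.solved := by
      rw [solved, subst, Multiset.filter_map, Multiset.card_map, solved]
      congr 1
      refine Multiset.filter_congr fun c _ => ?_
      cases c <;> rfl
    have hc : Multiset.card (φ.subst X Y) = Multiset.card φ := Multiset.card_map _ _
    simp only [weight, solved_cons_eq, Multiset.card_cons]
    omega

theorem Step.not_exists_infinite (φ : Clause S F V) :
    ¬ ∃ c : ℕ → Clause S F V, c 0 = φ ∧ ∀ n, Step L (c n) (c (n + 1)) := by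
  rintro ⟨c, -, hc⟩
  exact not_strictAnti_of_wellFoundedLT (fun n => (c n).weight)
    (strictAnti_nat_of_succ_lt fun n => (hc n).weight_lt)

/-! ### From a solved clause to a normal term. -/

namespace OSFTerm

/-- The number of arguments at the root. -/
def arity : OSFTerm S F V → ℕ
  | mk _ _ n _ _ => n

/-- The root tags, root sorts and arities of the subterms. -/
def nodes (t : OSFTerm S F V) : Multiset (V × S × ℕ) :=
  t.subterms.map fun r => (r.root, r.rootSort, r.arity)

theorem nodes_mk (X : V) (s : S) (n : ℕ) (f : Fin n → F) (t : Fin n → OSFTerm S F V) :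
    (mk X s n f t).nodes = (X, s, n) ::ₘ ∑ i, (t i).nodes := by
  rw [nodes, subterms, Multiset.map_cons]
  exact congrArg (Multiset.cons _) (map_sum (Multiset.mapAddMonoidHom _) _ _)

theorem eq_sortedVar_iff {t : OSFTerm S F V} {X : V} {s : S} :
    t = sortedVar X s ↔ t.root = X ∧ t.rootSort = s ∧ t.arity = 0 := by
  cases t with
  | mk Y r n f u =>
    constructor
    · intro h
      rw [h]
      exact ⟨rfl, rfl, rfl⟩
    · rintro ⟨rfl, rfl, h⟩
      change n = 0 at h
      subst h
      rw [sortedVar, Subsingleton.elim f Fin.elim0, Subsingleton.elim u Fin.elim0]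
      rfl

/-- The change at the single index is recorded by a term added on each side, which avoids
subtraction of multisets when a leaf is replaced. -/
theorem sum_add_eq_of_eq_off {M : Type*} [AddCommMonoid M] {ι : Type*} [Fintype ι] (g g' : ι → M)
    (i : ι) (a b : M) (h : ∀ j, j ≠ i → g' j = g j) (hi : g' i + a = g i + b) :
    ∑ j, g' j + a = ∑ j, g j + b := by
  rw [← Finset.add_sum_erase _ g (Finset.mem_univ i), ← Finset.add_sum_erase _ g' (Finset.mem_univ i),
    Finset.sum_congr rfl fun j hj => h j (Finset.ne_of_mem_erase hj), add_right_comm, hi,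
    add_right_comm]

/-- One occurrence of a leaf `Y : s` can be replaced with a term rooted at `Y`. -/
theorem exists_replace_leaf {t r : OSFTerm S F V} {s : S} (ht : t.LocallyNormal L)
    (hr : r.LocallyNormal L) (h : sortedVar r.root s ∈ t.subterms) :
    ∃ t' : OSFTerm S F V, t'.root = t.root ∧ t'.LocallyNormal L ∧
      t'.featClause = t.featClause + r.featClause ∧
      t'.nodes + {(r.root, s, 0)} = t.nodes + r.nodes := by
  induction t with
  | mk X s' n f u ih =>
    obtain h | ⟨i, h⟩ := mem_subterms_mk.1 h
    · rw [← h]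
      refine ⟨r, rfl, hr, ?_, ?_⟩
      · simp [sortedVar, featClause]
      · rw [sortedVar, nodes_mk, add_comm]
        simp
    · obtain ⟨v, hv1, hv2, hv3, hv4⟩ := ih i (ht.2.2 i) h
      have hoff : ∀ j, j ≠ i → Function.update u i v j = u j := fun j hj =>
        Function.update_of_ne hj _ _
      refine ⟨mk X s' n f (Function.update u i v), rfl, ⟨ht.1, ht.2.1, fun j => ?_⟩, ?_, ?_⟩
      · by_cases hj : j = i
        · rw [hj, Function.update_self]; exact hv2
        · rw [hoff j hj]; exact ht.2.2 j
      · rw [← add_zero (featClause _)]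
        refine sum_add_eq_of_eq_off _ _ i _ _ (fun j hj => by rw [hoff j hj]) ?_
        rw [Function.update_self, hv1, hv3, add_zero, Multiset.cons_add]
      · rw [nodes_mk, nodes_mk, Multiset.cons_add, Multiset.cons_add]
        refine congrArg (Multiset.cons _) (sum_add_eq_of_eq_off _ _ i _ _
          (fun j hj => by rw [hoff j hj]) ?_)
        rw [Function.update_self, hv4]

theorem mem_tags_iff_nodes {t : OSFTerm S F V} {X : V} :
    X ∈ t.tags ↔ ∃ s n, (X, s, n) ∈ t.nodes := by
  rw [mem_tags_iff]
  simp only [nodes, Multiset.mem_map, Prod.mk.injEq]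
  constructor
  · rintro ⟨r, hr, rfl⟩
    exact ⟨_, _, r, hr, rfl, rfl, rfl⟩
  · rintro ⟨s, n, r, hr, rfl, -⟩
    exact ⟨r, hr, rfl⟩

theorem appears_iff_nodes {t : OSFTerm S F V} {X : V} {s : S} :
    t.Appears X s ↔ ∃ n, (X, s, n) ∈ t.nodes := by
  simp only [Appears, nodes, Multiset.mem_map, Prod.mk.injEq]
  constructor
  · rintro ⟨r, hr, rfl, rfl⟩
    exact ⟨_, r, hr, rfl, rfl, rfl⟩
  · rintro ⟨n, r, hr, rfl, rfl, -⟩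
    exact ⟨r, hr, rfl, rfl⟩

theorem sortedVar_mem_subterms {t : OSFTerm S F V} {X : V} {s : S} (h : (X, s, 0) ∈ t.nodes) :
    sortedVar X s ∈ t.subterms := by
  obtain ⟨r, hr, he⟩ := Multiset.mem_map.1 h
  simp only [Prod.mk.injEq] at he
  rwa [← eq_sortedVar_iff.2 he]

/-- Every tag is reached from the root along features; this yields the connectedness of the final
clause. -/
theorem tags_induction {t : OSFTerm S F V} {P : V → Prop} (h0 : P t.root)
    (h : ∀ X f Y, Constraint.feat X f Y ∈ t.featClause → P X → P Y) : ∀ X ∈ t.tags, P X := by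
  induction t with
  | mk Y s n f u ih =>
    intro X hX
    obtain rfl | ⟨i, hX⟩ := mem_tags_mk.1 hX
    · exact h0
    · exact ih i (h _ _ _ (mem_featClause_mk.2 ⟨i, Or.inl rfl⟩) h0)
        (fun X f Y hm => h X f Y (mem_featClause_mk.2 ⟨i, Or.inr hm⟩)) X hX

end OSFTerm

/-- The constraint is a feature constraint on a tag of `E`. -/
def Constraint.HasSource (E : Finset V) : Constraint S F V → Prop
  | feat X _ _ => X ∈ E
  | _ => False

theorem Constraint.HasSource.exists_eq {E : Finset V} {c : Constraint S F V} (h : c.HasSource E) :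
    ∃ X ∈ E, ∃ f Y, c = feat X f Y := by
  cases c with
  | feat X f Y => exact ⟨X, h, f, Y, rfl⟩
  | _ => exact h.elim

/-- This lists the arguments of a node in the form required by `OSFTerm.mk`. Functionality together
with the absence of repetitions makes the features distinct. -/
theorem exists_fin_enumeration {m : Clause S F V} (hm : m.Nodup) {X : V}
    (hX : ∀ c ∈ m, ∃ f Y, c = Constraint.feat X f Y)
    (hfun : ∀ f Y Y', Constraint.feat X f Y ∈ m → Constraint.feat X f Y' ∈ m → Y = Y') :
    ∃ (f : Fin (Multiset.card m) → F) (g : Fin (Multiset.card m) → V), Function.Injective f ∧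
      m = ∑ i, {Constraint.feat X (f i) (g i)} := by
  induction m using Quot.inductionOn with
  | h l =>
  change l.Nodup at hm
  have hget : ∀ i : Fin l.length, ∃ f Y, l.get i = Constraint.feat X f Y := fun i =>
    hX _ (l.get_mem i)
  choose f g hfg using hget
  refine ⟨f, g, fun (i j : Fin l.length) (hij : f i = f j) => ?_, ?_⟩
  · have hi : Constraint.feat X (f i) (g i) ∈ l := hfg i ▸ l.get_mem i
    have hj : Constraint.feat X (f j) (g j) ∈ l := hfg j ▸ l.get_mem j
    rw [← hij] at hj
    refine List.nodup_iff_injective_get.1 hm ?_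
    rw [hfg, hfg, hfun _ _ _ hi hj, hij]
  · have h1 : (l : Multiset (Constraint S F V)) = Finset.univ.val.map l.get := by
      rw [Fin.univ_val_map, List.ofFn_get]
    have h2 : ∑ i : Fin l.length, {Constraint.feat X (f i) (g i)} =
        ∑ i : Fin l.length, ({l.get i} : Multiset (Constraint S F V)) :=
      Finset.sum_congr rfl fun i _ => by rw [hfg]
    refine Eq.trans ?_ h2.symm
    change (l : Multiset (Constraint S F V)) = _
    conv_lhs => rw [h1]
    rw [Finset.sum, ← Multiset.sum_map_singleton (Finset.univ.val.map l.get), Multiset.map_map]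
    rfl

/-- Solved clauses: no equalities, one sort constraint (with sort `σ X`) for each tag `X ∈ T`, one
feature constraint at most for each tag and feature, and all tags reachable from `r`. -/
structure RootedSolved (L : FuzzyLattice S) (Φ : Clause S F V) (T : Finset V) (σ : V → S)
    (r : V) : Prop where
  nodup : Φ.Nodup
  notEq : ∀ c ∈ Φ, c.NotEq
  sort_mem_iff : ∀ X s, Constraint.sort X s ∈ Φ ↔ X ∈ T ∧ s = σ X
  ne_bot : ∀ X ∈ T, σ X ≠ L.bot
  functional : ∀ X f Y Y', Constraint.feat X f Y ∈ Φ → Constraint.feat X f Y' ∈ Φ → Y = Y'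
  feat_mem : ∀ X f Y, Constraint.feat X f Y ∈ Φ → X ∈ T ∧ Y ∈ T
  root_mem : r ∈ T
  reach : ∀ X ∈ T, Relation.ReflTransGen (fun X Y => ∃ f, Constraint.feat X f Y ∈ Φ) r X

namespace RootedSolved

variable {Φ : Clause S F V} {T : Finset V} {σ : V → S} {r : V}

theorem top_ne_bot (h : RootedSolved L Φ T σ r) : L.top ≠ L.bot := by
  intro e
  refine h.ne_bot r h.root_mem (L.sub_antisymm _ _ ?_ ?_)
  · rw [← e, L.sub_top]; exact zero_lt_one
  · rw [L.bot_sub]; exact zero_lt_one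

/-- The term `t` has the constraints of `Φ` on the tags of `E`; all other occurrences of tags are
leaves of sort `⊤`, with the tags `M`. -/
structure Expands (L : FuzzyLattice S) (Φ : Clause S F V) (T : Finset V) (σ : V → S) (r : V)
    (E : Finset V) (M : Multiset V) (t : OSFTerm S F V) : Prop where
  root : t.root = r
  locallyNormal : t.LocallyNormal L
  featClause : t.featClause = Φ.filter (Constraint.HasSource E)
  nodes : t.nodes =
    E.val.map (fun X => (X, σ X, Multiset.card (Φ.filter (Constraint.HasSource {X})))) +
      M.map fun Y => (Y, L.top, 0)
  leaves : ∀ Y ∈ M, Y ∈ T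

theorem filter_hasSource_insert (Φ : Clause S F V) {E : Finset V} {Y : V} (hY : Y ∉ E) :
    Φ.filter (Constraint.HasSource (insert Y E)) =
      Φ.filter (Constraint.HasSource E) + Φ.filter (Constraint.HasSource {Y}) := by
  rw [Multiset.filter_add_filter, (Multiset.filter_eq_nil (s := Φ)
    (p := fun c => Constraint.HasSource E c ∧ Constraint.HasSource {Y} c)).2, add_zero]
  · refine Multiset.filter_congr fun c _ => ?_
    cases c <;> simp [Constraint.HasSource, or_comm]
  · rintro c - ⟨h1, h2⟩
    cases c with
    | feat X f Z =>
      simp only [Constraint.HasSource, Finset.mem_singleton] at h1 h2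
      exact hY (h2 ▸ h1)
    | _ => exact h1

/-- Some tag outside of `E` is a leaf, unless `E` has all tags. -/
theorem exists_leaf (h : RootedSolved L Φ T σ r) {E : Finset V} {M : Multiset V}
    {t : OSFTerm S F V} (ht : Expands L Φ T σ r E M t) (hE : ∃ X ∈ T, X ∉ E) :
    ∃ Y ∈ T, Y ∉ E ∧ Y ∈ M := by
  have key : ∀ Y ∈ t.tags, Y ∉ E → Y ∈ M := by
    intro Y hY hYE
    obtain ⟨s, n, hn⟩ := OSFTerm.mem_tags_iff_nodes.1 hY
    rw [ht.nodes, Multiset.mem_add, Multiset.mem_map, Multiset.mem_map] at hn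
    obtain ⟨X, hX, e⟩ | ⟨X, hX, e⟩ := hn
    · exact absurd ((Prod.mk.inj e).1 ▸ hX) hYE
    · exact (Prod.mk.inj e).1 ▸ hX
  obtain ⟨X, hX, hXE⟩ := hE
  have hreach := h.reach X hX
  suffices ∃ Y ∈ t.tags, Y ∉ E by
    obtain ⟨Y, hY, hYE⟩ := this
    exact ⟨Y, ht.leaves Y (key Y hY hYE), hYE, key Y hY hYE⟩
  induction hreach with
  | refl => exact ⟨r, ht.root ▸ t.root_mem_tags, hXE⟩
  | @tail U W _ hUW ih =>
    obtain ⟨f, hf⟩ := hUW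
    -- Walk back along a path from the root to a missing tag. If the predecessor is in `E`, its edge
    -- already lies in `t`, so the current tag occurs there; otherwise the predecessor is itself
    -- missing.
    by_cases hU : U ∈ E
    · have : Constraint.feat U f W ∈ t.featClause := by
        rw [ht.featClause]
        exact Multiset.mem_filter.2 ⟨hf, hU⟩
      exact ⟨W, (OSFTerm.featClause_tags this).2, hXE⟩
    · exact ih (h.feat_mem _ _ _ hf).1 hU

/-- One leaf `Y : ⊤` is replaced by a node carrying the sort of `Y` and all its features in `Φ`,
each leading to a new leaf of sort `⊤`. Other leaves tagged `Y` remain, as normality permits. -/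
theorem Expands.exists_insert (h : RootedSolved L Φ T σ r) {E : Finset V} {M : Multiset V}
    {t : OSFTerm S F V} (ht : Expands L Φ T σ r E M t) {Y : V} (hYT : Y ∈ T) (hYE : Y ∉ E)
    (hYM : Y ∈ M) : ∃ M' t', Expands L Φ T σ r (insert Y E) M' t' := by
  have hm : ∀ c ∈ Φ.filter (Constraint.HasSource {Y}), ∃ f Z, c = Constraint.feat Y f Z := by
    intro c hc
    obtain ⟨X, hX, f, Z, rfl⟩ := (Multiset.mem_filter.1 hc).2.exists_eq
    exact ⟨f, Z, by rw [Finset.mem_singleton.1 hX]⟩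
  obtain ⟨f, g, hf, hsum⟩ := exists_fin_enumeration (h.nodup.filter _) hm
    fun f Z Z' hZ hZ' => h.functional Y f Z Z' (Multiset.mem_of_mem_filter hZ)
      (Multiset.mem_of_mem_filter hZ')
  let q : OSFTerm S F V := .mk Y (σ Y) _ f fun i => .sortedVar (g i) L.top
  have hq : q.LocallyNormal L :=
    ⟨h.ne_bot Y hYT, hf, fun i => ⟨h.top_ne_bot, fun i => i.elim0, fun i => i.elim0⟩⟩
  have hqf : q.featClause = Φ.filter (Constraint.HasSource {Y}) := by
    conv_rhs => rw [hsum]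
    refine Finset.sum_congr rfl fun i _ => ?_
    simp [OSFTerm.sortedVar, OSFTerm.featClause]
  have hqn : q.nodes = (Y, σ Y, Multiset.card (Φ.filter (Constraint.HasSource {Y}))) ::ₘ
      (Finset.univ.val.map g).map fun Z => (Z, L.top, 0) := by
    rw [OSFTerm.nodes_mk, Multiset.map_map,
      ← Multiset.sum_map_singleton (Multiset.map _ Finset.univ.val), Multiset.map_map]
    refine congrArg (Multiset.cons _) (Finset.sum_congr rfl fun i _ => ?_)
    simp [OSFTerm.sortedVar, OSFTerm.nodes_mk]
  have hleaf : OSFTerm.sortedVar q.root L.top ∈ t.subterms := by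
    refine OSFTerm.sortedVar_mem_subterms ?_
    rw [ht.nodes]
    exact Multiset.mem_add.2 (Or.inr (Multiset.mem_map_of_mem _ hYM))
  obtain ⟨t', h1, h2, h3, h4⟩ := OSFTerm.exists_replace_leaf ht.locallyNormal hq hleaf
  obtain ⟨M₀, rfl⟩ := Multiset.exists_cons_of_mem hYM
  refine ⟨M₀ + Finset.univ.val.map g, t', h1.trans ht.root, h2, ?_, ?_, ?_⟩
  · rw [h3, ht.featClause, hqf, filter_hasSource_insert Φ hYE]
  · refine add_right_cancel (h4.trans ?_)
    rw [ht.nodes, hqn, Finset.insert_val_of_notMem hYE]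
    simp only [Multiset.map_add, Multiset.map_singleton, ← Multiset.singleton_add]
    change _ = _ + {(Y, L.top, 0)}
    abel
  · intro Z hZ
    obtain hZ | hZ := Multiset.mem_add.1 hZ
    · exact ht.leaves Z (Multiset.mem_cons_of_mem hZ)
    · obtain ⟨i, -, rfl⟩ := Multiset.mem_map.1 hZ
      have : Constraint.feat Y (f i) (g i) ∈ Φ.filter (Constraint.HasSource {Y}) := by
        rw [hsum]
        exact Multiset.mem_sum.2 ⟨i, Finset.mem_univ i, Multiset.mem_singleton_self _⟩
      exact (h.feat_mem _ _ _ (Multiset.mem_of_mem_filter this)).2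

/-- Start from the single leaf `r : ⊤` with `E = ∅` and expand one tag at a time. Since each tag is
expanded once only, cycles in `Φ` cause no infinite unfolding. -/
theorem exists_expands (h : RootedSolved L Φ T σ r) : ∃ M t, Expands L Φ T σ r T M t := by
  have key : ∀ k ≤ T.card, ∃ E ⊆ T, E.card = k ∧ ∃ M t, Expands L Φ T σ r E M t := by
    intro k
    induction k with
    | zero =>
      refine fun _ => ⟨∅, Finset.empty_subset T, rfl, {r}, .sortedVar r L.top, rfl,
        ⟨h.top_ne_bot, fun i => i.elim0, fun i => i.elim0⟩, ?_, ?_, ?_⟩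
      · rw [(Multiset.filter_eq_nil (s := Φ)).2]
        · simp [OSFTerm.sortedVar, OSFTerm.featClause]
        · intro c _ hc
          obtain ⟨X, hX, -⟩ := hc.exists_eq
          simp at hX
      · simp [OSFTerm.sortedVar, OSFTerm.nodes_mk]
      · simpa using h.root_mem
    | succ k ih =>
      intro hk
      obtain ⟨E, hET, hE, M, t, ht⟩ := ih (by omega)
      obtain ⟨Y, hYT, hYE, hYM⟩ := h.exists_leaf ht
        (Finset.exists_mem_notMem_of_card_lt_card (by omega))
      exact ⟨insert Y E, Finset.insert_subset hYT hET, by rw [Finset.card_insert_of_notMem hYE, hE],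
        ht.exists_insert h hYT hYE hYM⟩
  obtain ⟨E, hET, hE, M, t, ht⟩ := key _ le_rfl
  obtain rfl := Finset.eq_of_subset_of_card_le hET hE.ge
  exact ⟨M, t, ht⟩

/-- Every rooted solved clause is the clause of a normal term. -/
theorem exists_toClause_eq (h : RootedSolved L Φ T σ r) :
    ∃ t : OSFTerm S F V, t.IsNormal L ∧ t.root = r ∧ t.toClause L = Φ := by
  obtain ⟨M, t, ht⟩ := h.exists_expands
  have htags : t.tags = T := by
    ext X
    rw [OSFTerm.mem_tags_iff_nodes, ht.nodes]
    simp only [Multiset.mem_add, Multiset.mem_map, Prod.mk.injEq]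
    constructor
    · rintro ⟨s, n, ⟨X, hX, rfl, -⟩ | ⟨X, hX, rfl, -⟩⟩
      · exact hX
      · exact ht.leaves _ hX
    · exact fun hX => ⟨_, _, Or.inl ⟨X, hX, rfl, rfl, rfl⟩⟩
  have hsort : ∀ X ∈ T, t.sortOf L X = σ X := by
    intro X hX
    refine OSFTerm.sortOf_eq ?_ fun s' hs' => ?_
    · rw [OSFTerm.appears_iff_nodes, ht.nodes]
      exact ⟨_, Multiset.mem_add.2 (Or.inl (Multiset.mem_map_of_mem _ hX))⟩
    · obtain ⟨n, hn⟩ := OSFTerm.appears_iff_nodes.1 hs'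
      rw [ht.nodes, Multiset.mem_add, Multiset.mem_map, Multiset.mem_map] at hn
      simp only [Prod.mk.injEq] at hn
      obtain ⟨Y, -, rfl, rfl, -⟩ | ⟨Y, -, rfl, rfl, -⟩ := hn
      · rw [L.sub_refl]; exact zero_lt_one
      · rw [L.sub_top]; exact zero_lt_one
  refine ⟨t, ⟨ht.locallyNormal, fun Y _ => ?_⟩, ht.root, ?_⟩
  -- For normality, only expanded nodes can differ from `Y : ⊤`, and there is one of them for each
  -- tag of `T`.
  · have e : Multiset.card (t.subterms.filter fun q => q.root = Y ∧ q ≠ .sortedVar Y L.top) =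
        t.nodes.countP fun p => p.1 = Y ∧ ¬ (p.2.1 = L.top ∧ p.2.2 = 0) := by
      rw [OSFTerm.nodes, Multiset.countP_map]
      congr 1
      refine Multiset.filter_congr fun q _ => and_congr_right fun hq => ?_
      rw [ne_eq, OSFTerm.eq_sortedVar_iff, and_iff_right hq]
    rw [e, ht.nodes, Multiset.countP_add, Multiset.countP_map, Multiset.countP_map,
      (Multiset.filter_eq_nil (s := M)).2 (by simp), Multiset.card_zero, add_zero]
    refine le_trans (Multiset.card_le_card (Multiset.monotone_filter_right T.val
      (q := fun X => Y = X) fun X hX => hX.1.symm)) ?_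
    rw [← Multiset.countP_eq_card_filter]
    exact Multiset.nodup_iff_count_le_one.1 T.nodup Y
  · have hnd : (T.val.map fun X => (Constraint.sort X (σ X) : Constraint S F V)).Nodup :=
      T.nodup.map fun X Y e => (Constraint.sort.inj e).1
    rw [OSFTerm.toClause, htags, Multiset.map_congr rfl fun X hX => by rw [hsort X hX],
      ht.featClause]
    refine (Multiset.Nodup.ext (Multiset.nodup_add.2 ⟨hnd, h.nodup.filter _, ?_⟩) h.nodup).2 ?_
    · refine Multiset.disjoint_left.2 fun hc hc' => ?_
      obtain ⟨X, -, rfl⟩ := Multiset.mem_map.1 hc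
      exact (Multiset.mem_filter.1 hc').2
    · intro c
      rw [Multiset.mem_add, Multiset.mem_map, Multiset.mem_filter]
      cases c with
      | sort X s =>
        rw [h.sort_mem_iff]
        simp [Constraint.HasSource, eq_comm]
      | eq X Y =>
        simp only [reduceCtorEq, and_false, exists_false, Constraint.HasSource, or_false, false_iff]
        exact fun hc => h.notEq _ hc
      | feat X f Y =>
        simp only [reduceCtorEq, and_false, exists_false, Constraint.HasSource, false_or,
          and_iff_left_iff_imp]
        exact fun hc => (h.feat_mem _ _ _ hc).1

end RootedSolved

/-! ### Fully normalized clauses and existence of an output. -/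

namespace Clause

theorem exists_cons_cons_of_mem {ι : Type*} {m : Multiset ι} {a b : ι} (ha : a ∈ m) (hb : b ∈ m)
    (hab : a ≠ b) : ∃ m', m = a ::ₘ b ::ₘ m' := by
  obtain ⟨m₁, rfl⟩ := Multiset.exists_cons_of_mem ha
  obtain ⟨m₂, rfl⟩ := Multiset.exists_cons_of_mem
    ((Multiset.mem_cons.1 hb).resolve_left (Ne.symm hab))
  exact ⟨m₂, rfl⟩

theorem TagEquiv.hasTag {φ : Clause S F V} {X Y : V} (h : φ.TagEquiv X Y) (hX : φ.HasTag X) :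
    φ.HasTag Y := by
  induction h with
  | refl => exact hX
  | tail _ hs _ =>
    obtain hs | hs := hs <;> exact ⟨_, hs, by simp [Constraint.tags]⟩

theorem HasTag.of_solved {φ : Clause S F V} {X : V} (h : φ.solved.HasTag X) : φ.HasTag X := by
  obtain ⟨c, hc, hX⟩ := h
  exact ⟨c, Multiset.mem_of_mem_filter hc, hX⟩

theorem finite_hasTag (φ : Clause S F V) : {X | φ.HasTag X}.Finite :=
  φ.occurrences.toFinset.finite_toSet.subset fun X hX => by
    simpa [mem_occurrences] using hX

end Clause

/-- A clause has finitely many tags, so the representatives of their classes embed into the infinite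
set of unused variables. -/
theorem exists_isClassNaming [Infinite V] (φ : Clause S F V) : ∃ z, IsClassNaming φ z := by
  have hfin := φ.finite_hasTag
  let s : Setoid V := ⟨φ.TagEquiv, fun _ => .refl, Clause.TagEquiv.symm, fun h h' => h.trans h'⟩
  let ρ : V → V := fun X => (Quotient.mk s X).out
  have hρ : ∀ X Y, ρ X = ρ Y ↔ φ.TagEquiv X Y := fun X Y =>
    Quotient.out_injective.eq_iff.trans Quotient.eq
  have hinf : Infinite ({X | φ.HasTag X}ᶜ : Set V) := hfin.infinite_compl.to_subtype
  have hfin' : Finite (ρ '' {X | φ.HasTag X}) := (hfin.image ρ).to_subtype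
  obtain ⟨e⟩ : Nonempty (ρ '' {X | φ.HasTag X} ↪ ({X | φ.HasTag X}ᶜ : Set V)) :=
    ⟨(Finite.equivFin _).toEmbedding.trans
      ((Fin.valEmbedding).trans (Infinite.natEmbedding _))⟩
  let z : V → V := fun X => if h : ρ X ∈ ρ '' {X | φ.HasTag X} then e ⟨ρ X, h⟩ else X
  have hz : ∀ X (hX : φ.HasTag X), z X = e ⟨ρ X, Set.mem_image_of_mem ρ hX⟩ := fun X hX =>
    dif_pos (Set.mem_image_of_mem ρ hX)
  refine ⟨z, fun X hX => ⟨?_, fun Y hY => ?_⟩⟩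
  · rw [hz X hX]
    exact (e _).2
  · rw [hz X hX, hz Y hY, Subtype.coe_inj, e.injective.eq_iff, Subtype.mk.injEq, hρ]

/-- Clauses to which no rule applies, other than the inconsistent ones. -/
structure ConsistentNormal (L : FuzzyLattice S) (φ : Clause S F V) : Prop where
  not_step : ∀ φ', ¬ Step L φ φ'
  ne_bot : ¬ ∃ X, φ = {Constraint.sort X L.bot}

namespace ConsistentNormal

variable {φ : Clause S F V}

theorem sort_unique (h : ConsistentNormal L φ) {X : V} {s s' : S}
    (hs : Constraint.sort X s ∈ φ) (hs' : Constraint.sort X s' ∈ φ) : s = s' := by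
  by_contra hne
  obtain ⟨φ₀, rfl⟩ := Clause.exists_cons_cons_of_mem hs hs' fun e => hne (Constraint.sort.inj e).2
  exact h.not_step _ (.sortIntersection φ₀ X s s')

theorem feat_unique (h : ConsistentNormal L φ) {X Y Y' : V} {f : F}
    (hY : Constraint.feat X f Y ∈ φ) (hY' : Constraint.feat X f Y' ∈ φ) : Y = Y' := by
  by_contra hne
  obtain ⟨φ₀, rfl⟩ := Clause.exists_cons_cons_of_mem hY hY' fun e => hne (Constraint.feat.inj e).2.2
  exact h.not_step _ (.featureFunctionality φ₀ X f Y Y')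

theorem sort_ne_bot (h : ConsistentNormal L φ) {X : V} {s : S} (hs : Constraint.sort X s ∈ φ) :
    s ≠ L.bot := by
  rintro rfl
  obtain ⟨φ₀, rfl⟩ := Multiset.exists_cons_of_mem hs
  by_cases h0 : φ₀ = 0
  · exact h.ne_bot ⟨X, by rw [h0]; rfl⟩
  · exact h.not_step _ (.inconsistentSort φ₀ X h0)

/-- The merging rules also apply to two copies of the same constraint, since clauses are multisets.
-/
theorem nodup_solved (h : ConsistentNormal L φ) : φ.solved.Nodup := by
  refine Multiset.nodup_iff_le.2 fun c hc => ?_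
  have hn : c.NotEq := (Multiset.mem_filter.1 (Multiset.subset_of_le hc
    (Multiset.mem_cons_self _ _))).2
  obtain ⟨φ₀, hφ⟩ := Multiset.le_iff_exists_add.1 (hc.trans (Multiset.filter_le _ _))
  rw [Multiset.cons_add, Multiset.cons_add, zero_add] at hφ
  subst hφ
  cases c with
  | sort X s => exact h.not_step _ (.sortIntersection φ₀ X s s)
  | eq X Y => exact hn
  | feat X f Y => exact h.not_step _ (.featureFunctionality φ₀ X f Y Y)

/-- The right-hand side of a nontrivial equality has no other occurrence. -/
theorem eq_of_hasTag_rhs (h : ConsistentNormal L φ) {X Y : V} (hXY : X ≠ Y)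
    (he : Constraint.eq X Y ∈ φ) {c : Constraint S F V} (hc : c ∈ φ) (hY : Y ∈ c.tags) :
    c = Constraint.eq X Y := by
  by_contra hne
  obtain ⟨φ₀, rfl⟩ := Multiset.exists_cons_of_mem he
  exact h.not_step _ (.tagElimination φ₀ X Y hXY ⟨c, (Multiset.mem_cons.1 hc).resolve_left hne, hY⟩)

/-- Each class of tags has one tag at most that occurs in the solved part. -/
theorem eq_of_tagEquiv (h : ConsistentNormal L φ) {X Y : V} (hX : φ.solved.HasTag X)
    (hY : φ.solved.HasTag Y) (hXY : φ.TagEquiv X Y) : X = Y := by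
  -- Send the right-hand side of a nontrivial equality to its left-hand side and fix all other tags.
  -- As a right-hand side occurs nowhere else, `ρ` is constant on classes and fixes every tag of the
  -- solved part.
  let ρ : V → V := fun Y => if h : ∃ X, X ≠ Y ∧ Constraint.eq X Y ∈ φ then h.choose else Y
  have hρ_eq : ∀ U W, U ≠ W → Constraint.eq U W ∈ φ → ρ W = U := by
    intro U W hUW hm
    have hex : ∃ X, X ≠ W ∧ Constraint.eq X W ∈ φ := ⟨U, hUW, hm⟩
    have e : ρ W = hex.choose := dif_pos hex
    rw [e]
    exact (Constraint.eq.inj (h.eq_of_hasTag_rhs hUW hm hex.choose_spec.2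
      (by simp [Constraint.tags]))).1
  have hρ_self : ∀ U W, U ≠ W → Constraint.eq U W ∈ φ → ρ U = U := by
    intro U W hUW hm
    refine dif_neg ?_
    rintro ⟨Z, hZ, hZm⟩
    exact hUW (Constraint.eq.inj (h.eq_of_hasTag_rhs hZ hZm hm (by simp [Constraint.tags]))).2.symm
  have hρ_solved : ∀ U, φ.solved.HasTag U → ρ U = U := by
    rintro U ⟨c, hc, hU⟩
    refine dif_neg ?_
    rintro ⟨Z, hZ, hZm⟩
    rw [Clause.solved, Multiset.mem_filter] at hc
    rw [h.eq_of_hasTag_rhs hZ hZm hc.1 hU] at hc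
    exact hc.2
  have hstep : ∀ U W, Constraint.eq U W ∈ φ → ρ U = ρ W := by
    intro U W hm
    by_cases hUW : U = W
    · rw [hUW]
    · rw [hρ_eq U W hUW hm, hρ_self U W hUW hm]
  have : ρ X = ρ Y := by
    clear hY
    induction hXY with
    | refl => rfl
    | tail _ hs ih => exact ih.trans (hs.elim (hstep _ _) fun hs => (hstep _ _ hs).symm)
  rwa [hρ_solved X hX, hρ_solved Y hY] at this

end ConsistentNormal

/-- Normality of the final clause makes the renamed clause functional, with one sort for each tag,
because `z` is injective on tags of the solved part. Refinement of the initial clause provides a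
sort in every class and a path from the root to it. -/
theorem exists_returns [Infinite V] {ψ₁ ψ₂ : OSFTerm S F V} {φ : Clause S F V}
    (hφ : IsNormalization L ψ₁ ψ₂ φ) : ∃ ψ β, Returns L ψ₁ ψ₂ φ ψ β := by
  by_cases hbot : ∃ X, φ = {Constraint.sort X L.bot}
  · obtain ⟨X, hX⟩ := hbot
    exact ⟨_, _, Or.inl ⟨X, hX, rfl, rfl⟩⟩
  have hN : ConsistentNormal L φ := ⟨hφ.2, hbot⟩
  have hRef := (Clause.Refines.of_reflTransGen hφ.1).resolve_left hbot
  obtain ⟨z, hz⟩ := exists_isClassNaming φ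
  have hzeq : ∀ {X Y}, φ.HasTag X → φ.TagEquiv X Y → z X = z Y := fun hX h =>
    ((hz _ hX).2 _ (h.hasTag hX)).2 h
  have hinj : ∀ {X Y}, φ.solved.HasTag X → φ.solved.HasTag Y → z X = z Y → X = Y :=
    fun hX hY h => hN.eq_of_tagEquiv hX hY (((hz _ hX.of_solved).2 _ hY.of_solved).1 h)
  have hsorted : ∀ X, φ.HasTag X → ∃ Y s, φ.TagEquiv X Y ∧ Constraint.sort Y s ∈ φ := by
    intro X hX
    obtain h | h := hasTag_initialClause_iff.1 ((hRef.tag X).1 hX) <;>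
    exact hRef.sort X _ (by
      simp only [initialClause, Multiset.mem_add, OSFTerm.mem_toClause_iff]
      first
      | exact Or.inl (Or.inl (Or.inl ⟨X, h, rfl⟩))
      | exact Or.inl (Or.inr (Or.inl ⟨X, h, rfl⟩)))
  have hmem : ∀ {c}, c ∈ φ → c.NotEq → c.rename z ∈ φ.solved.map (Constraint.rename z) :=
    fun hc hn => Multiset.mem_map_of_mem _ (Multiset.mem_filter.2 ⟨hc, hn⟩)
  have hTσ : ∀ Z, ∃ s, (∃ X, φ.HasTag X ∧ z X = Z) →
      Constraint.sort Z s ∈ φ.solved.map (Constraint.rename z) := by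
    intro Z
    by_cases hZ : ∃ X, φ.HasTag X ∧ z X = Z
    · obtain ⟨X, hX, rfl⟩ := hZ
      obtain ⟨Y, s, hXY, hs⟩ := hsorted X hX
      refine ⟨s, fun _ => ?_⟩
      rw [hzeq hX hXY]
      exact hmem hs trivial
    -- A default that makes `σ` total; it is irrelevant off the image of the tags.
    · exact ⟨L.top, fun h => absurd h hZ⟩
  choose σ hσ using hTσ
  have sort_inv : ∀ {Z s}, Constraint.sort Z s ∈ φ.solved.map (Constraint.rename z) →
      ∃ X, z X = Z ∧ Constraint.sort X s ∈ φ ∧ φ.solved.HasTag X := by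
    intro Z s h
    obtain ⟨c, hc, e⟩ := Multiset.mem_map.1 h
    cases c <;> cases e
    exact ⟨_, rfl, Multiset.mem_of_mem_filter hc, _, hc, by simp [Constraint.tags]⟩
  have feat_inv : ∀ {Z f W}, Constraint.feat Z f W ∈ φ.solved.map (Constraint.rename z) →
      ∃ X Y, z X = Z ∧ z Y = W ∧ Constraint.feat X f Y ∈ φ ∧ φ.solved.HasTag X ∧
        φ.solved.HasTag Y := by
    intro Z f W h
    obtain ⟨c, hc, e⟩ := Multiset.mem_map.1 h
    cases c <;> cases e
    exact ⟨_, _, rfl, rfl, Multiset.mem_of_mem_filter hc, ⟨_, hc, by simp [Constraint.tags]⟩,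
      _, hc, by simp [Constraint.tags]⟩
  have huniq : ∀ {Z s s'}, Constraint.sort Z s ∈ φ.solved.map (Constraint.rename z) →
      Constraint.sort Z s' ∈ φ.solved.map (Constraint.rename z) → s = s' := by
    intro Z s s' h h'
    obtain ⟨X, rfl, hX, hXs⟩ := sort_inv h
    obtain ⟨X', e, hX', hXs'⟩ := sort_inv h'
    obtain rfl := hinj hXs' hXs e
    exact hN.sort_unique hX hX'
  have htag : ∀ {X}, X ∈ ψ₁.tags ∨ X ∈ ψ₂.tags → φ.HasTag X := fun h =>
    (hRef.tag _).2 (hasTag_initialClause_iff.2 h)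
  have hreach : ∀ X, φ.HasTag X → Relation.ReflTransGen
      (fun X Y => ∃ f, Constraint.feat X f Y ∈ φ.solved.map (Constraint.rename z))
      (z ψ₁.root) (z X) := by
    -- Each feature edge of the original terms survives, up to equivalence of its ends, and `z`
    -- identifies equivalent tags. Reachability in the two terms thus transfers to the renamed
    -- clause.
    have hedge : ∀ X f Y, Constraint.feat X f Y ∈ initialClause L ψ₁ ψ₂ →
        Relation.ReflTransGen
          (fun X Y => ∃ f, Constraint.feat X f Y ∈ φ.solved.map (Constraint.rename z))
          (z ψ₁.root) (z X) →
        Relation.ReflTransGen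
          (fun X Y => ∃ f, Constraint.feat X f Y ∈ φ.solved.map (Constraint.rename z))
          (z ψ₁.root) (z Y) := by
      intro X f Y hm hX
      obtain ⟨X', Y', hXX, hm', hYY⟩ := hRef.feat X f Y hm
      have hXt : φ.HasTag X := (hRef.tag X).2 ⟨_, hm, by simp [Constraint.tags]⟩
      rw [← hzeq (X := Y') ⟨_, hm', by simp [Constraint.tags]⟩ hYY]
      rw [hzeq hXt hXX] at hX
      exact hX.tail ⟨f, hmem hm' trivial⟩
    have hroots : z ψ₁.root = z ψ₂.root :=
      hzeq (htag (Or.inl ψ₁.root_mem_tags)) (hRef.equiv _ _ (by simp [initialClause]))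
    intro X hX
    obtain h | h := hasTag_initialClause_iff.1 ((hRef.tag X).1 hX)
    · refine OSFTerm.tags_induction .refl (fun X f Y hm => hedge X f Y ?_) X h
      simp [initialClause, OSFTerm.mem_toClause_iff, hm]
    · refine OSFTerm.tags_induction (hroots ▸ .refl) (fun X f Y hm => hedge X f Y ?_) X h
      simp [initialClause, OSFTerm.mem_toClause_iff, hm]
  have hmemT : ∀ {Z}, Z ∈ φ.finite_hasTag.toFinset.image z ↔ ∃ X, φ.HasTag X ∧ z X = Z := by
    simp
  have hR : RootedSolved L (φ.solved.map (Constraint.rename z)) (φ.finite_hasTag.toFinset.image z) σ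
      (z ψ₁.root) := by
    refine ⟨?_, ?_, ?_, ?_, ?_, ?_, ?_, ?_⟩
    -- Injectivity of `z` on tags of the solved part keeps distinct constraints distinct after
    -- renaming.
    · refine Multiset.Nodup.map_on (fun c hc c' hc' e => ?_) hN.nodup_solved
      have key : ∀ {X X'}, X ∈ c.tags → X' ∈ c'.tags → z X = z X' → X = X' := fun hX hX' =>
        hinj ⟨c, hc, hX⟩ ⟨c', hc', hX'⟩
      cases c with
      | sort X s =>
        cases c' <;> simp only [Constraint.rename, reduceCtorEq, Constraint.sort.injEq] at e
        rw [key (by simp [Constraint.tags]) (by simp [Constraint.tags]) e.1, e.2]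
      | eq X Y => exact (Multiset.mem_filter.1 hc).2.elim
      | feat X f Y =>
        cases c' <;> simp only [Constraint.rename, reduceCtorEq, Constraint.feat.injEq] at e
        rw [key (X := X) (by simp [Constraint.tags]) (by simp [Constraint.tags]) e.1, e.2.1,
          key (X := Y) (by simp [Constraint.tags]) (by simp [Constraint.tags]) e.2.2]
    · intro c hc
      obtain ⟨c, hcs, rfl⟩ := Multiset.mem_map.1 hc
      have := (Multiset.mem_filter.1 hcs).2
      cases c <;> exact this
    · intro Z s
      rw [hmemT]
      constructor
      · intro h
        obtain ⟨X, hXZ, hX, hXs⟩ := sort_inv h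
        have hZ : ∃ X, φ.HasTag X ∧ z X = Z := ⟨X, hXs.of_solved, hXZ⟩
        exact ⟨hZ, huniq h (hσ Z hZ)⟩
      · rintro ⟨hZ, rfl⟩
        exact hσ Z hZ
    · intro Z hZ
      obtain ⟨X, -, hX, -⟩ := sort_inv (hσ Z (hmemT.1 hZ))
      exact hN.sort_ne_bot hX
    · intro Z f W W' h h'
      obtain ⟨X, Y, rfl, rfl, hm, hX, hY⟩ := feat_inv h
      obtain ⟨X', Y', e, rfl, hm', hX', hY'⟩ := feat_inv h'
      obtain rfl := hinj hX' hX e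
      rw [hN.feat_unique hm hm']
    · intro Z f W h
      obtain ⟨X, Y, rfl, rfl, hm, hX, hY⟩ := feat_inv h
      exact ⟨hmemT.2 ⟨X, hX.of_solved, rfl⟩, hmemT.2 ⟨Y, hY.of_solved, rfl⟩⟩
    · exact hmemT.2 ⟨_, htag (Or.inl ψ₁.root_mem_tags), rfl⟩
    · intro Z hZ
      obtain ⟨X, hX, rfl⟩ := hmemT.1 hZ
      exact hreach X hX
  obtain ⟨ψ, hψ, hroot, hclause⟩ := hR.exists_toClause_eq
  exact ⟨ψ, _, Or.inr ⟨hbot, z, hz, hψ, hroot, hclause, rfl⟩⟩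

end

end OSF

theorem mainTheorem7 {S F V : Type u} [Finite S] [Countable V] [Infinite V]
    (L : OSF.FuzzyLattice S) (ψ₁ ψ₂ : OSF.OSFTerm S F V)
    (h₁ : ψ₁.IsNormal L) (h₂ : ψ₂.IsNormal L) (hdisj : Disjoint ψ₁.tags ψ₂.tags) :
    -- the normalization loop always terminates
    (¬ ∃ c : ℕ → OSF.Clause S F V,
      c 0 = OSF.initialClause L ψ₁ ψ₂ ∧ ∀ n, OSF.Step L (c n) (c (n + 1))) ∧
    -- whatever rules were applied, the procedure then returns a pair
    (∀ φ, OSF.IsNormalization L ψ₁ ψ₂ φ → ∃ ψ β, OSF.Returns L ψ₁ ψ₂ φ ψ β) ∧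
    -- every pair that it returns is the unifier together with the unification degree
    (∀ ψ β, OSF.UnifyOutput L ψ₁ ψ₂ ψ β → OSF.OSFTerm.IsUnifierWithDegree L ψ₁ ψ₂ ψ β) :=
  ⟨OSF.Step.not_exists_infinite _, fun _ => OSF.exists_returns,
    fun _ _ h => h.isUnifierWithDegree h₁ h₂ hdisj⟩
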